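/- Let $d\ge 1$, let $u:\mathbb Z^d\to\mathbb R$ be summable and not identically zero, let $\mu$ be a probability measure on $\mathbb R$ with a density $\rho$ of finite total variation, whose total variation is denoted $\|\rho\|_{\rm BV}$, and let $(\omega_k)_{k\in\mathbb Z^d}$ be independent random variables with distribution $\mu$. For $\lambda>0$ let $$(H_\omega\psi)(x)=-\sum_{|e|_1=1}\psi(x+e)+\lambda V_\omega(x)\psi(x),\qquad V_\omega(x)=\sum_{k\in\mathbb Z^d}\omega_k u(x-k),\qquad x\in\mathbb Z^d ,$$ and let $H_{\omega,L}$ be the compression of $H_\omega$ to $\ell^2(\Lambda_L)$, where $\Lambda_L=\{k\in\mathbb Z^d:|k|_\infty\le L\}$. Let $\chi_I(H_{\omega,L})$ be the spectral projection of $H_{\omega,L}$ onto $I$. In each of the following estimates the random variable $\operatorname{Tr}\chi_{[E-\epsilon,E+\epsilon]}(H_{\omega,L})$ is integrable. (a) There is a constant $c_u>0$ depending only on $u$ such that, if $n\in\mathbb N_0$ and $u$ has support in $[0,n]^d\cap\mathbb Z^d$, then for all integers $L\ge1$, all $E\in\mathbb R$ and all $\epsilon,\lambda>0$ $$\mathbb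 E\{\operatorname{Tr}\chi_{[E-\epsilon,E+\epsilon]}(H_{\omega,L})\}\le \frac{c_u}{\lambda}\,|\operatorname{supp}u|\,\|\rho\|_{\rm BV}\,\epsilon\,(2L+n)^{d(n+1)} .$$ (b) Assume that $\bar u=\sum_{k}u(k)\ne0$, that $\rho$ has compact support, and that $m\in\mathbb N_0$ satisfies $\sum_{\|k\|_1\ge m}|u(k)|\le|\bar u/2|$. Then for all integers $L\ge1$, all $E\in\mathbb R$ and all $\epsilon,\lambda>0$ $$\mathbb E\{\operatorname{Tr}\chi_{[E-\epsilon,E+\epsilon]}(H_{\omega,L})\}\le \frac{8}{\lambda|\bar u|}\,\min\bigl((2L+1)^d,|\operatorname{supp}u|\bigr)\,\|\rho\|_{\rm BV}\,\epsilon\,(2L+m)^{d} ,$$ and if $L\ge d$, then $(2L+1)^d$ can be replaced by $(2L)^d$ in this bound. (c) Assume that there are $C,\alpha>0$ with $|u(k)|\le Ce^{-\alpha\|k\|_1}$ for all $k\in\mathbb Z^d$. Then there are $c_u>0$ and $I_0\in\mathbb N_0^d$, both depending only on $u$, such that, if $\rho$ has bounded support, then for all integers $L\ge1$, all $E\in\mathbb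 R$ and all $\epsilon,\lambda>0$ $$\mathbb E\{\operatorname{Tr}\chi_{[E-\epsilon,E+\epsilon]}(H_{\omega,L})\}\le \frac{c_u}{\lambda}\,\|\rho\|_{\rm BV}\,\epsilon\,(2L+1)^{2d+|I_0|},$$ where $|I_0|$ is the sum of the entries of $I_0$. -/

import Mathlib

open MeasureTheory

noncomputable section

namespace AlloyType

variable {d : ℕ}

/-- The `ℓ¹` norm on the lattice `ℤ^d`. -/
def l1norm (x : Fin d → ℤ) : ℤ := ∑ i, |x i|

/-- The cube `Λ_L = {k ∈ ℤ^d : |k|_∞ ≤ L}`, which has `(2L+1)^d` points. -/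
def cube (d L : ℕ) : Finset (Fin d → ℤ) :=
  Finset.Icc (fun _ => -(L : ℤ)) (fun _ => (L : ℤ))

/-- The lattice vectors `e` with `|e|_1 = 1` (their coordinates lie in `{-1, 0, 1}`). -/
def unitVectors (d : ℕ) : Finset (Fin d → ℤ) :=
  (Finset.Icc (fun _ => -1) (fun _ => 1)).filter (fun e => l1norm e = 1)

/-- The discrete Laplace operator `(Δψ)(x) = ∑_{|e|_1 = 1} ψ(x + e)`. -/
def laplace (ψ : (Fin d → ℤ) → ℂ) (x : Fin d → ℤ) : ℂ :=
  ∑ e ∈ unitVectors d, ψ (x + e)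

/-- The alloy-type potential `V_ω(x) = ∑_k ω_k u(x - k)`. -/
def potential (u ω : (Fin d → ℤ) → ℝ) (x : Fin d → ℤ) : ℝ :=
  ∑' k, ω k * u (x - k)

/-- The action of `H_ω = -Δ + lam V_ω` on functions on the lattice. -/
def hamiltonian (u : (Fin d → ℤ) → ℝ) (lam : ℝ) (ω : (Fin d → ℤ) → ℝ)
    (ψ : (Fin d → ℤ) → ℂ) (x : Fin d → ℤ) : ℂ :=
  -laplace ψ x + ((lam * potential u ω x : ℝ) : ℂ) * ψ x

/-- The restriction `H_{ω,L}` of `H_ω` to `ℓ²(Λ_L)`, that is, the compression of `H_ω` to the cube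
`Λ_L`, as a matrix in the basis `(δ_k)` of `ℓ²(Λ_L)`: the entry at `(x, y)` is `(H_ω δ_y)(x)`. -/
def restricted (u : (Fin d → ℤ) → ℝ) (lam : ℝ) (L : ℕ) (ω : (Fin d → ℤ) → ℝ) :
    Matrix (cube d L) (cube d L) ℂ :=
  Matrix.of fun x y => hamiltonian u lam ω (Pi.single (y : Fin d → ℤ) 1) x

/-- `Tr χ_I(H_{ω,L})`, where `χ_I(H_{ω,L})` is the spectral projection given by the functional
calculus of the Hermitian matrix `H_{ω,L}`. -/
def spectralTrace (u : (Fin d → ℤ) → ℝ) (lam : ℝ) (L : ℕ) (I : Set ℝ)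
    (ω : (Fin d → ℤ) → ℝ) : ℝ :=
  (cfc (I.indicator (fun _ => (1 : ℝ))) (restricted u lam L ω)).trace.re

/-- The law of independent coupling constants `(ω_k)`, each with distribution `μ`. -/
def couplingLaw (d : ℕ) (μ : Measure ℝ) [IsProbabilityMeasure μ] :
    Measure ((Fin d → ℤ) → ℝ) :=
  Measure.infinitePi fun _ => μ

/-- `ρ` is a density of `μ`, of finite total variation. -/
structure IsBVDensity (μ : Measure ℝ) (ρ : ℝ → ℝ) : Prop where
  nonneg : ∀ x, 0 ≤ ρ x
  measurable : Measurable ρ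
  boundedVariation : BoundedVariationOn ρ Set.univ
  eq_withDensity : μ = volume.withDensity (fun x => ENNReal.ofReal (ρ x))

/-- The total variation `‖ρ‖_BV`. -/
def bvNorm (ρ : ℝ → ℝ) : ℝ := (eVariationOn ρ Set.univ).toReal

/-- The Wegner bound `E{Tr χ_{[E-ε,E+ε]}(H_{ω,L})} ≤ K`. Integrability is part of the claim. -/
def WegnerBound (u : (Fin d → ℤ) → ℝ) (lam : ℝ) (μ : Measure ℝ) [IsProbabilityMeasure μ]
    (L : ℕ) (E ε K : ℝ) : Prop :=
  Integrable (spectralTrace u lam L (Set.Icc (E - ε) (E + ε))) (couplingLaw d μ) ∧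
    ∫ ω, spectralTrace u lam L (Set.Icc (E - ε) (E + ε)) ω ∂(couplingLaw d μ) ≤ K

/-- `min(M, |supp u|)`, with `|supp u| = ∞` allowed. -/
def minSupp (u : (Fin d → ℤ) → ℝ) (M : ℕ) : ℕ :=
  (min (M : ℕ∞) (Function.support u).encard).toNat

/-- `H_{ω,L}` is Hermitian, so that its functional calculus is not a default value. -/
theorem restricted_isHermitian (u : (Fin d → ℤ) → ℝ) (lam : ℝ) (L : ℕ)
    (ω : (Fin d → ℤ) → ℝ) : (restricted u lam L ω).IsHermitian := by
  have key : ∀ x y : Fin d → ℤ,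
      laplace (Pi.single y (1 : ℂ)) x = if y - x ∈ unitVectors d then 1 else 0 := by
    intro x y
    simp only [laplace, Pi.single_apply]
    simp_rw [show ∀ e, (x + e = y) ↔ (e = y - x) from
      fun e => ⟨fun h => by simp [← h], fun h => by simp [h]⟩]
    rw [Finset.sum_ite_eq']
  have hsym : ∀ z : Fin d → ℤ, z ∈ unitVectors d ↔ -z ∈ unitVectors d := by
    intro z
    have hn : l1norm (-z) = l1norm z := by simp [l1norm]
    simp only [unitVectors, Finset.mem_filter, Finset.mem_Icc, hn, Pi.le_def, Pi.neg_apply]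
    constructor
    · rintro ⟨⟨h1, h2⟩, h3⟩
      exact ⟨⟨fun i => by linarith [h2 i], fun i => by linarith [h1 i]⟩, h3⟩
    · rintro ⟨⟨h1, h2⟩, h3⟩
      exact ⟨⟨fun i => by linarith [h2 i], fun i => by linarith [h1 i]⟩, h3⟩
  refine Matrix.IsHermitian.ext fun x y => ?_
  have h := hsym ((x : Fin d → ℤ) - y)
  rw [neg_sub] at h
  simp only [restricted, Matrix.of_apply, hamiltonian, key, Pi.single_apply, h]
  by_cases hxy : (x : Fin d → ℤ) = y
  · simp [hxy, Complex.conj_ofReal]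
  · simp [hxy, Ne.symm hxy, apply_ite]

end AlloyType

end

/-! Let `N(ω)` be the number of eigenvalues of `H_{ω,L}` that are at most `E + ε`. Suppose that a
finite combination `∑ a_k u(x - k)` of translates of `u` is at least `δ > 0` on `Λ_L`. Adding `t
a_k` to each `ω_k`, with `lam t δ = 2ε + η`, raises `H_{ω,L}` by at least `2ε + η`. The number of
eigenvalues in the window is therefore at most the drop of `N` under this shift.

The mean drop is estimated one variable at a time. Changing a single `ω_k` alters the diagonal at no
more than `r` sites, those of `Λ_L` in `k + supp u`, so `N` oscillates by at most `r` in that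
variable. Moving a translation by `h` onto the density bounds the mean change by `r/2 · |h| ·
‖ρ‖_BV`, through the `L¹` modulus of continuity of `ρ`. No sign of `u`, hence no monotonicity in a
single `ω_k`, is needed. This gives `wegnerBound_of_covering`, with the bound `ε / (lam δ) · ∑ |a_k|
· r · ‖ρ‖_BV`; the three parts differ in the choice of `a`.

For nonzero mean, `a` is the constant sign of the mean on an `ℓ¹` neighbourhood of the cube, whose
size is controlled by `card_cubeNhd_add_le`. In the other two parts `a_k = ± k^I`, where `I` is
minimal among the multi-indices with `∑ k^I u(k) ≠ 0`. Expanding `(x - k)^I` shows that the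
convolution of `k^I` with `u` is a nonzero constant (`hasSum_latticeMonomial_mul_sub`). For finite
support the relevant sum is already finite; for exponential decay it is truncated to a cube of size
proportional to `L`.

A nonzero moment exists by Lagrange interpolation when the support is finite. Under exponential
decay, the positive and negative parts of `u` would otherwise be measures with equal moments and
analytic moment generating functions, hence equal. -/

noncomputable section

namespace AlloyType

variable {d : ℕ}

/-! ### Eigenvalue counts of Hermitian matrices under diagonal perturbations. -/

section EigenvalueCounting

variable {X : Type*} [Fintype X] [DecidableEq X]

open Matrix

/-- The number of eigenvalues of a Hermitian matrix lying in a set, counted with multiplicity. -/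
def eigenCount {A : Matrix X X ℂ} (hA : A.IsHermitian) (I : Set ℝ) : ℕ :=
  Nat.card {i // hA.eigenvalues i ∈ I}

theorem eigenCount_le_card {A : Matrix X X ℂ} (hA : A.IsHermitian) (I : Set ℝ) :
    eigenCount hA I ≤ Fintype.card X := by
  rw [← Nat.card_eq_fintype_card]
  exact Nat.card_le_card_of_injective _ Subtype.val_injective

theorem eigenCount_mono {A : Matrix X X ℂ} (hA : A.IsHermitian) {I J : Set ℝ} (h : I ⊆ J) :
    eigenCount hA I ≤ eigenCount hA J :=
  Nat.card_le_card_of_injective (Subtype.impEmbedding _ _ fun _ hi => h hi)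
    (Subtype.impEmbedding _ _ fun _ hi => h hi).injective

theorem eigenCount_sdiff {A : Matrix X X ℂ} (hA : A.IsHermitian) {I J : Set ℝ} (h : I ⊆ J) :
    (eigenCount hA (J \ I) : ℝ) = eigenCount hA J - eigenCount hA I := by
  classical
  simp only [eigenCount, Nat.card_eq_fintype_card, Fintype.card_subtype]
  rw [← Nat.cast_sub (Finset.card_le_card (fun i hi => by
    simp only [Finset.mem_filter, Finset.mem_univ, true_and] at hi ⊢; exact h hi)),
    ← Finset.card_sdiff_of_subset (fun i hi => by
    simp only [Finset.mem_filter, Finset.mem_univ, true_and] at hi ⊢; exact h hi)]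
  congr 2
  ext i
  simp

/-- The trace of a spectral projection counts eigenvalues. -/
theorem trace_cfc_indicator {A : Matrix X X ℂ} (hA : A.IsHermitian) (I : Set ℝ) :
    (cfc (I.indicator (fun _ => (1 : ℝ))) A).trace.re = eigenCount hA I := by
  classical
  have h1 : (cfc (I.indicator (fun _ => (1 : ℝ))) A).trace
      = ∑ i, ((I.indicator (fun _ => (1 : ℝ)) (hA.eigenvalues i) : ℝ) : ℂ) := by
    rw [hA.cfc_eq, Matrix.IsHermitian.cfc, Unitary.conjStarAlgAut_apply, Matrix.trace_mul_cycle,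
      Unitary.coe_star_mul_self, one_mul, Matrix.trace_diagonal]
    rfl
  rw [h1, ← Complex.ofReal_sum, Complex.ofReal_re, eigenCount, Nat.card_eq_fintype_card,
    Fintype.card_subtype, Finset.card_filter]
  push_cast
  refine Finset.sum_congr rfl fun i _ => ?_
  by_cases h : hA.eigenvalues i ∈ I <;> simp [h]

/-- The coordinates of a vector with respect to an eigenbasis of a Hermitian matrix. -/
def eigenCoord {A : Matrix X X ℂ} (hA : A.IsHermitian) (x : X → ℂ) : X → ℂ :=
  (star (hA.eigenvectorUnitary : Matrix X X ℂ)) *ᵥ x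

theorem star_eigenCoord {A : Matrix X X ℂ} (hA : A.IsHermitian) (x : X → ℂ) :
    star (eigenCoord hA x) = star x ᵥ* (hA.eigenvectorUnitary : Matrix X X ℂ) := by
  rw [eigenCoord, Matrix.star_mulVec, Matrix.star_eq_conjTranspose,
    Matrix.conjTranspose_conjTranspose]

theorem eigenvectorUnitary_mulVec_eigenCoord {A : Matrix X X ℂ} (hA : A.IsHermitian)
    (x : X → ℂ) : (hA.eigenvectorUnitary : Matrix X X ℂ) *ᵥ eigenCoord hA x = x := by
  rw [eigenCoord, Matrix.mulVec_mulVec,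
    Unitary.mul_star_self_of_mem hA.eigenvectorUnitary.2, Matrix.one_mulVec]

theorem eigenCoord_eigenvectorUnitary_mulVec {A : Matrix X X ℂ} (hA : A.IsHermitian)
    (x : X → ℂ) : eigenCoord hA ((hA.eigenvectorUnitary : Matrix X X ℂ) *ᵥ x) = x := by
  rw [eigenCoord, Matrix.mulVec_mulVec, Unitary.coe_star_mul_self, Matrix.one_mulVec]

/-- The quadratic form of a Hermitian matrix in the coordinates of an eigenbasis. -/
theorem quadForm_eq_sum {A : Matrix X X ℂ} (hA : A.IsHermitian) (x : X → ℂ) :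
    (star x ⬝ᵥ (A *ᵥ x)).re = ∑ i, hA.eigenvalues i * ‖eigenCoord hA x i‖ ^ 2 := by
  have h := hA.spectral_theorem
  rw [Unitary.conjStarAlgAut_apply] at h
  conv_lhs => rw [h]
  rw [← Matrix.mulVec_mulVec, ← Matrix.mulVec_mulVec, Matrix.dotProduct_mulVec,
    ← star_eigenCoord, dotProduct, Complex.re_sum]
  refine Finset.sum_congr rfl fun i _ => ?_
  change (star (eigenCoord hA x i) * (diagonal _ *ᵥ eigenCoord hA x) i).re = _
  rw [Matrix.mulVec_diagonal, Function.comp_apply, Complex.star_def, mul_left_comm,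
    Complex.conj_mul', ← Complex.ofReal_pow]
  exact (congrArg Complex.re (Complex.ofReal_mul _ _).symm).trans (Complex.ofReal_re _)

theorem sum_norm_sq_eigenCoord {A : Matrix X X ℂ} (hA : A.IsHermitian) (x : X → ℂ) :
    ∑ i, ‖eigenCoord hA x i‖ ^ 2 = ∑ i, ‖x i‖ ^ 2 := by
  have key : ∀ y : X → ℂ, ((∑ i, ‖y i‖ ^ 2 : ℝ) : ℂ) = star y ⬝ᵥ y := by
    intro y
    rw [dotProduct]
    push_cast
    exact Finset.sum_congr rfl fun i _ => (Complex.conj_mul' _).symm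
  apply Complex.ofReal_injective
  rw [key, key, star_eigenCoord, ← Matrix.dotProduct_mulVec,
    eigenvectorUnitary_mulVec_eigenCoord]

/-- Comparison of eigenvalue counts of two Hermitian matrices whose forms are comparable on the
vectors vanishing on a finite set of coordinates. -/
theorem eigenCount_le_add_card {A B : Matrix X X ℂ} (hA : A.IsHermitian) (hB : B.IsHermitian)
    {E E' : ℝ} (D : Finset X)
    (h : ∀ x : X → ℂ, (∀ p ∈ D, x p = 0) →
      (star x ⬝ᵥ (B *ᵥ x)).re - E' * ∑ i, ‖x i‖ ^ 2
        ≤ (star x ⬝ᵥ (A *ᵥ x)).re - E * ∑ i, ‖x i‖ ^ 2) :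
    eigenCount hA (Set.Iic E) ≤ eigenCount hB (Set.Iic E') + D.card := by
  classical
  -- Dimension count: `f` parametrizes the span of the eigenvectors of `A` with eigenvalue at most
  -- `E`, and `g` records the low eigencoordinates for `B` together with the coordinates in `D`. On
  -- the kernel of `g ∘ f` the shifted form of `A` is nonpositive and that of `B` is nonnegative, so
  -- the hypothesis forces both to vanish.
  let emb : {i // hA.eigenvalues i ∈ Set.Iic E} → X := Subtype.val
  let f : ({i // hA.eigenvalues i ∈ Set.Iic E} → ℂ) →ₗ[ℂ] (X → ℂ) :=
    (hA.eigenvectorUnitary : Matrix X X ℂ).mulVecLin ∘ₗ Function.ExtendByZero.linearMap ℂ emb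
  let g : (X → ℂ) →ₗ[ℂ] ({i // hB.eigenvalues i ∈ Set.Iic E'} → ℂ) × (D → ℂ) :=
    (LinearMap.funLeft ℂ ℂ (Subtype.val) ∘ₗ
      (star (hB.eigenvectorUnitary : Matrix X X ℂ)).mulVecLin).prod
    (LinearMap.funLeft ℂ ℂ (Subtype.val))
  have hinj : Function.Injective (g ∘ₗ f) := by
    rw [← LinearMap.ker_eq_bot, LinearMap.ker_eq_bot']
    intro c hc
    set x := f c with hx
    have hc' : g x = 0 := hc
    have hg1 : ∀ i, hB.eigenvalues i ≤ E' → eigenCoord hB x i = 0 := fun i hi =>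
      congrFun (congrArg Prod.fst hc') ⟨i, hi⟩
    have hg2 : ∀ p ∈ D, x p = 0 := fun p hp => congrFun (congrArg Prod.snd hc') ⟨p, hp⟩
    have hcoord : eigenCoord hA x = Function.extend emb c 0 :=
      eigenCoord_eigenvectorUnitary_mulVec hA _
    have hA0 : (star x ⬝ᵥ (A *ᵥ x)).re - E * ∑ i, ‖x i‖ ^ 2 ≤ 0 := by
      rw [quadForm_eq_sum hA, ← sum_norm_sq_eigenCoord hA, Finset.mul_sum,
        ← Finset.sum_sub_distrib]
      refine Finset.sum_nonpos fun i _ => ?_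
      by_cases hi : hA.eigenvalues i ≤ E
      · rw [← sub_mul]
        exact mul_nonpos_of_nonpos_of_nonneg (by linarith) (by positivity)
      · have : eigenCoord hA x i = 0 := by
          rw [hcoord, Function.extend_apply']
          · rfl
          · rintro ⟨⟨j, hj⟩, rfl⟩
            exact hi hj
        simp [this]
    have hB0 := (h x hg2).trans hA0
    rw [quadForm_eq_sum hB, ← sum_norm_sq_eigenCoord hB, Finset.mul_sum,
      ← Finset.sum_sub_distrib] at hB0
    have hnn : ∀ i ∈ Finset.univ, 0 ≤ hB.eigenvalues i * ‖eigenCoord hB x i‖ ^ 2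
        - E' * ‖eigenCoord hB x i‖ ^ 2 := by
      intro i _
      by_cases hi : hB.eigenvalues i ≤ E'
      · simp [hg1 i hi]
      · rw [← sub_mul]
        exact mul_nonneg (by linarith) (by positivity)
    have hz := (Finset.sum_eq_zero_iff_of_nonneg hnn).1
      (le_antisymm hB0 (Finset.sum_nonneg hnn))
    -- The remaining eigenvalues of `B` lie strictly above `E'`, so a vanishing form kills their
    -- coordinates too.
    have hy : eigenCoord hB x = 0 := by
      ext i
      by_cases hi : hB.eigenvalues i ≤ E'
      · exact hg1 i hi
      · have h1 := hz i (Finset.mem_univ _)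
        rw [← sub_mul, mul_eq_zero] at h1
        rcases h1 with h1 | h1
        · exact absurd h1 (by linarith)
        · simpa using h1
    have hx0 : x = 0 := by
      rw [← eigenvectorUnitary_mulVec_eigenCoord hB x, hy, Matrix.mulVec_zero]
    ext i
    have h2 : eigenCoord hA x (emb i) = c i := by
      rw [hcoord, Subtype.val_injective.extend_apply]
    rw [← h2, hx0, eigenCoord, Matrix.mulVec_zero]
    rfl
  have hfin := LinearMap.finrank_le_finrank_of_injective hinj
  rw [Module.finrank_prod, Module.finrank_fintype_fun_eq_card, Module.finrank_fintype_fun_eq_card,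
    Module.finrank_fintype_fun_eq_card, Fintype.card_coe] at hfin
  simpa only [eigenCount, Nat.card_eq_fintype_card] using hfin

theorem isHermitian_add_diagonal {Y : Type*} [DecidableEq Y] {T : Matrix Y Y ℂ}
    (hT : T.IsHermitian) (v : Y → ℝ) :
    (T + diagonal (fun p => (v p : ℂ))).IsHermitian :=
  hT.add (Matrix.isHermitian_diagonal_of_self_adjoint _ (by ext p; simp))

/-- The number of eigenvalues `≤ E` of the Hermitian matrix `T` perturbed by the diagonal `v`. -/
def levelCount {T : Matrix X X ℂ} (hT : T.IsHermitian) (v : X → ℝ) (E : ℝ) : ℕ :=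
  eigenCount (isHermitian_add_diagonal hT v) (Set.Iic E)

/-- Each site where the diagonals are not comparable costs at most one eigenvalue. With `D` empty
this is monotonicity in the potential; with `D` the sites reached by one coupling constant it bounds
the oscillation in that variable. -/
theorem levelCount_le_add_card {T : Matrix X X ℂ} (hT : T.IsHermitian) {v w : X → ℝ}
    {E E' : ℝ} (D : Finset X) (h : ∀ p ∉ D, w p - E' ≤ v p - E) :
    levelCount hT v E ≤ levelCount hT w E' + D.card := by
  have key : ∀ (v : X → ℝ) (x : X → ℂ),
      (star x ⬝ᵥ ((T + diagonal (fun p => (v p : ℂ))) *ᵥ x)).re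
        = (star x ⬝ᵥ (T *ᵥ x)).re + ∑ i, v i * ‖x i‖ ^ 2 := by
    intro v x
    rw [Matrix.add_mulVec, dotProduct_add, Complex.add_re]
    congr 1
    rw [dotProduct, Complex.re_sum]
    refine Finset.sum_congr rfl fun i _ => ?_
    rw [Matrix.mulVec_diagonal, Pi.star_apply, Complex.star_def, mul_left_comm,
      Complex.conj_mul', ← Complex.ofReal_pow, ← Complex.ofReal_mul, Complex.ofReal_re]
  refine eigenCount_le_add_card _ _ D fun x hx => ?_
  rw [key, key, add_sub_assoc, add_sub_assoc, Finset.mul_sum, Finset.mul_sum,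
    ← Finset.sum_sub_distrib, ← Finset.sum_sub_distrib]
  refine add_le_add le_rfl (Finset.sum_le_sum fun i _ => ?_)
  by_cases hi : i ∈ D
  · simp [hx i hi]
  · rw [← sub_mul, ← sub_mul]
    exact mul_le_mul_of_nonneg_right (h i hi) (by positivity)

theorem levelCount_le {T : Matrix X X ℂ} (hT : T.IsHermitian) {v w : X → ℝ}
    {E E' : ℝ} (h : ∀ p, w p - E' ≤ v p - E) : levelCount hT v E ≤ levelCount hT w E' := by
  simpa using levelCount_le_add_card hT ∅ fun p _ => h p

theorem levelCount_le_card {T : Matrix X X ℂ} (hT : T.IsHermitian) (v : X → ℝ) (E : ℝ) :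
    levelCount hT v E ≤ Fintype.card X :=
  eigenCount_le_card _ _

open Filter Topology in
/-- Just above `E` there are no eigenvalues. -/
theorem exists_pos_eigenCount_Iic_add {A : Matrix X X ℂ} (hA : A.IsHermitian) (E : ℝ) :
    ∃ η > 0, eigenCount hA (Set.Iic (E + η)) = eigenCount hA (Set.Iic E) := by
  have h1 : ∀ᶠ η in 𝓝[>] (0 : ℝ), ∀ i, hA.eigenvalues i ≤ E + η → hA.eigenvalues i ≤ E := by
    rw [eventually_all]
    intro i
    by_cases hi : hA.eigenvalues i ≤ E
    · exact Eventually.of_forall fun _ _ => hi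
    · have : ∀ᶠ η in 𝓝[>] (0 : ℝ), η < hA.eigenvalues i - E :=
        nhdsWithin_le_nhds (Iio_mem_nhds (by linarith))
      filter_upwards [this] with η hη h
      linarith
  obtain ⟨η, hη, hη0⟩ := (h1.and self_mem_nhdsWithin).exists
  refine ⟨η, hη0, ?_⟩
  have : ∀ i, hA.eigenvalues i ∈ Set.Iic (E + η) ↔ hA.eigenvalues i ∈ Set.Iic E :=
    fun i => ⟨hη i, fun h => le_trans h (le_add_of_nonneg_right (le_of_lt hη0))⟩
  simp only [eigenCount, this]

open Filter Topology in
/-- Just below `E` there are no eigenvalues. -/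
theorem eventually_eigenCount_Iic_sub {A : Matrix X X ℂ} (hA : A.IsHermitian) (E : ℝ) :
    ∀ᶠ η in 𝓝[>] (0 : ℝ), eigenCount hA (Set.Iic (E - η)) = eigenCount hA (Set.Iio E) := by
  have h1 : ∀ᶠ η in 𝓝[>] (0 : ℝ), ∀ i, hA.eigenvalues i < E → hA.eigenvalues i ≤ E - η := by
    rw [eventually_all]
    intro i
    by_cases hi : hA.eigenvalues i < E
    · have : ∀ᶠ η in 𝓝[>] (0 : ℝ), η < E - hA.eigenvalues i :=
        nhdsWithin_le_nhds (Iio_mem_nhds (by linarith))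
      filter_upwards [this] with η hη h
      linarith
    · exact Eventually.of_forall fun _ h => absurd h hi
  filter_upwards [h1, self_mem_nhdsWithin] with η hη hη0
  have : ∀ i, hA.eigenvalues i ∈ Set.Iic (E - η) ↔ hA.eigenvalues i ∈ Set.Iio E :=
    fun i => ⟨fun h => lt_of_le_of_lt h (sub_lt_self E hη0), hη i⟩
  simp only [eigenCount, this]

/-- A gap of width `η` above `E` survives: a change of the diagonal by less than `η` in sup norm
cannot bring the count at `E` above the old count at `E + η`. This is the source of measurability.
-/
theorem upperSemicontinuous_levelCount {T : Matrix X X ℂ} (hT : T.IsHermitian) (E : ℝ) :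
    UpperSemicontinuous fun v : X → ℝ => levelCount hT v E := by
  intro v n hn
  obtain ⟨η, hη, h⟩ := exists_pos_eigenCount_Iic_add (isHermitian_add_diagonal hT v) E
  filter_upwards [Metric.ball_mem_nhds v hη] with w hw
  refine lt_of_le_of_lt (?_ : levelCount hT w E ≤ levelCount hT v (E + η)) (by
    rwa [levelCount, h])
  refine levelCount_le hT fun p => ?_
  have := (dist_le_pi_dist w v p).trans_lt hw
  rw [Real.dist_eq, abs_lt] at this
  linarith [this.1]

theorem measurable_levelCount {T : Matrix X X ℂ} (hT : T.IsHermitian) (E : ℝ) :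
    Measurable fun v : X → ℝ => levelCount hT v E :=
  (upperSemicontinuous_levelCount hT E).measurable

end EigenvalueCounting

/-! ### Translations of a density of bounded variation. -/

section Variation

open Set

/-- The increments of a function of bounded variation along a doubly infinite arithmetic
progression. -/
theorem tsum_edist_int_le (ρ : ℝ → ℝ) {h : ℝ} (hh : 0 < h) (x : ℝ) :
    ∑' n : ℤ, edist (ρ (n • h + x)) (ρ (n • h + x - h)) ≤ eVariationOn ρ univ := by
  rw [ENNReal.tsum_eq_iSup_sum]
  refine iSup_le fun s => ?_
  obtain ⟨N, hN⟩ : ∃ N : ℕ, ∀ n ∈ s, -(N : ℤ) ≤ n ∧ n < N := by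
    refine ⟨∑ n ∈ s, (n.natAbs + 1), fun n hn => ?_⟩
    have := Finset.single_le_sum (f := fun n : ℤ => n.natAbs + 1) (fun _ _ => Nat.zero_le _) hn
    omega
  have hmono : Monotone fun i : ℕ => ((i : ℤ) - N) • h + x - h := by
    intro i j hij
    simp only [zsmul_eq_mul]
    have : (i : ℝ) ≤ j := by exact_mod_cast hij
    push_cast
    nlinarith
  refine le_trans ?_ (eVariationOn.sum_le (f := ρ) (s := univ) (n := 2 * N) hmono
    (fun _ => mem_univ _))
  calc ∑ n ∈ s, edist (ρ (n • h + x)) (ρ (n • h + x - h))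
      ≤ ∑ n ∈ (Finset.range (2 * N)).image (fun i : ℕ => (i : ℤ) - N),
          edist (ρ (n • h + x)) (ρ (n • h + x - h)) := by
        refine Finset.sum_le_sum_of_subset fun n hn => ?_
        have := hN n hn
        exact Finset.mem_image.2 ⟨(n + N).toNat, by simp; omega, by omega⟩
    _ = ∑ i ∈ Finset.range (2 * N), edist (ρ (((i : ℤ) - N) • h + x))
          (ρ (((i : ℤ) - N) • h + x - h)) :=
        Finset.sum_image fun i _ j _ hij => by simpa using hij
    _ ≤ _ := by
        refine Finset.sum_le_sum fun i _ => le_of_eq ?_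
        congr 2
        push_cast
        simp only [zsmul_eq_mul]
        push_cast
        ring

/-- The translates of `(0, h]` tile the line. The integral becomes an integral over one period of
the sums of increments along `x + ℤh`, each of which is at most the total variation. -/
theorem lintegral_edist_shift_le {ρ : ℝ → ℝ} (hρ : Measurable ρ) {h : ℝ} (hh : 0 < h) :
    ∫⁻ x, edist (ρ x) (ρ (x - h)) ≤ ENNReal.ofReal h * eVariationOn ρ univ := by
  have hmeas : Measurable fun x => edist (ρ x) (ρ (x - h)) :=
    hρ.edist (hρ.comp (measurable_id.sub_const h))
  have hbij : Function.Bijective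
      (codRestrict (fun n : ℤ => n • h) (AddSubgroup.zmultiples h) fun n => ⟨n, rfl⟩) :=
    (Equiv.ofInjective (fun n : ℤ => n • h) (zsmul_left_strictMono hh).injective).bijective
  rw [(isAddFundamentalDomain_Ioc hh 0 volume).lintegral_eq_tsum'' fun x => edist (ρ x) (ρ (x - h)),
    ← ((Equiv.ofBijective _ hbij : ℤ ≃ AddSubgroup.zmultiples h)).tsum_eq]
  change ∑' n : ℤ, ∫⁻ x in Ioc 0 (0 + h), edist (ρ (n • h + x)) (ρ (n • h + x - h)) ≤ _
  rw [← lintegral_tsum fun n : ℤ => (show Measurable fun x =>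
    edist (ρ (n • h + x)) (ρ (n • h + x - h)) from
      hmeas.comp (measurable_const_add (n • h))).aemeasurable]
  refine (lintegral_mono fun x => tsum_edist_int_le ρ hh x).trans ?_
  rw [setLIntegral_const, Real.volume_Ioc, mul_comm]
  simp

/-- The `L¹` modulus of continuity of a function of bounded variation. -/
theorem integral_abs_sub_shift_le {ρ : ℝ → ℝ} (hρ : Measurable ρ)
    (hbv : BoundedVariationOn ρ univ) (h : ℝ) :
    ∫ x, |ρ x - ρ (x - h)| ≤ |h| * bvNorm ρ := by
  have hpos : ∀ h : ℝ, 0 < h → ∫ x, |ρ x - ρ (x - h)| ≤ h * bvNorm ρ := by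
    intro h hh
    rw [integral_eq_lintegral_of_nonneg_ae (Filter.Eventually.of_forall fun x => abs_nonneg _)
      (show Measurable fun x => |ρ x - ρ (x - h)| by fun_prop).aestronglyMeasurable]
    have h1 := lintegral_edist_shift_le hρ hh
    simp only [edist_dist, Real.dist_eq] at h1
    refine (ENNReal.toReal_mono (ENNReal.mul_ne_top ENNReal.ofReal_ne_top hbv) h1).trans ?_
    rw [ENNReal.toReal_mul, ENNReal.toReal_ofReal hh.le, bvNorm]
  rcases lt_trichotomy h 0 with hh | hh | hh
  · have h1 := hpos (-h) (by linarith)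
    rw [abs_of_neg hh]
    refine le_trans (le_of_eq ?_) h1
    rw [← integral_add_right_eq_self _ h]
    refine integral_congr_ae (Filter.Eventually.of_forall fun x => ?_)
    simp only [sub_neg_eq_add, add_sub_cancel_right]
    rw [abs_sub_comm]
  · simp [hh]
  · rw [abs_of_pos hh]
    exact hpos h hh

theorem IsBVDensity.integrable {μ : Measure ℝ} [IsProbabilityMeasure μ] {ρ : ℝ → ℝ}
    (hρ : IsBVDensity μ ρ) : Integrable ρ := by
  refine ⟨hρ.measurable.aestronglyMeasurable, ?_⟩
  have h1 : μ univ = 1 := measure_univ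
  rw [hρ.eq_withDensity, withDensity_apply _ MeasurableSet.univ, Measure.restrict_univ] at h1
  rw [hasFiniteIntegral_iff_ofReal (Filter.Eventually.of_forall hρ.nonneg), h1]
  exact ENNReal.one_lt_top

theorem IsBVDensity.integral_eq {μ : Measure ℝ} {ρ : ℝ → ℝ} (hρ : IsBVDensity μ ρ) (F : ℝ → ℝ) :
    ∫ s, F s ∂μ = ∫ s, ρ s * F s := by
  rw [hρ.eq_withDensity, integral_withDensity_eq_integral_toReal_smul
    hρ.measurable.ennreal_ofReal (Filter.Eventually.of_forall fun _ => ENNReal.ofReal_lt_top)]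
  simp only [ENNReal.toReal_ofReal (hρ.nonneg _), smul_eq_mul]

theorem integrable_of_bound {Ω : Type*} [MeasurableSpace Ω] {P : Measure Ω} [IsFiniteMeasure P]
    {F : Ω → ℝ} (hF : Measurable F) {C : ℝ} (hC : ∀ s, |F s| ≤ C) : Integrable F P :=
  Integrable.of_bound hF.aestronglyMeasurable C (Filter.Eventually.of_forall hC)

/-- Change of the mean of a function of oscillation at most `r` under a translation. -/
theorem IsBVDensity.integral_sub_shift_le {μ : Measure ℝ} [IsProbabilityMeasure μ] {ρ : ℝ → ℝ}
    (hρ : IsBVDensity μ ρ) {F : ℝ → ℝ} (hF : Measurable F) {r : ℝ}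
    (hr : ∀ s t, F s - F t ≤ r) (h : ℝ) :
    ∫ s, F s ∂μ - ∫ s, F (s + h) ∂μ ≤ r / 2 * |h| * bvNorm ρ := by
  have hbdd : BddBelow (range F) := by
    refine ⟨F 0 - r, ?_⟩
    rintro _ ⟨s, rfl⟩
    linarith [hr 0 s]
  -- Centring `F` costs nothing, since constants cancel in the difference of means, and it replaces
  -- the oscillation `r` by the sup bound `r / 2`.
  set c := (⨅ s, F s) + r / 2 with hc
  have hr0 : 0 ≤ r := by simpa using hr 0 0
  have hG : ∀ s, |F s - c| ≤ r / 2 := by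
    intro s
    have h1 : (⨅ s, F s) ≤ F s := ciInf_le hbdd s
    have h2 : F s - r ≤ ⨅ s, F s := le_ciInf fun t => by linarith [hr s t]
    rw [abs_le]
    constructor <;> linarith
  set G : ℝ → ℝ := fun s => F s - c with hGdef
  have hGm : Measurable G := hF.sub_const c
  have hFG : ∀ h : ℝ, ∫ s, F (s + h) ∂μ = ∫ s, G (s + h) ∂μ + c := by
    intro h
    have hi : Integrable (fun s => G (s + h)) μ :=
      integrable_of_bound (hGm.comp (measurable_add_const h)) fun s => hG _
    have := integral_add hi (integrable_const (μ := μ) c)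
    rw [integral_const, probReal_univ, one_smul] at this
    rw [← this]
    simp [hGdef]
  have h0 : ∫ s, F s ∂μ = ∫ s, G s ∂μ + c := by simpa using hFG 0
  -- The translation moves from the merely bounded function to the density.
  have hshift : ∫ s, ρ s * G (s + h) = ∫ s, ρ (s - h) * G s := by
    rw [← integral_sub_right_eq_self _ h]
    simp
  have hi1 : Integrable fun s => ρ s * G s :=
    hρ.integrable.mul_bdd hGm.aestronglyMeasurable (Filter.Eventually.of_forall hG)
  have hi2 : Integrable fun s => ρ (s - h) * G s :=
    (hρ.integrable.comp_sub_right h).mul_bdd hGm.aestronglyMeasurable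
      (Filter.Eventually.of_forall hG)
  have hi3 : Integrable fun s => |ρ s - ρ (s - h)| :=
    (hρ.integrable.sub (hρ.integrable.comp_sub_right h)).abs
  calc ∫ s, F s ∂μ - ∫ s, F (s + h) ∂μ
      = ∫ s, (ρ s * G s - ρ (s - h) * G s) := by
        rw [h0, hFG, hρ.integral_eq, hρ.integral_eq, hshift, integral_sub hi1 hi2]
        ring
    _ ≤ ∫ s, |ρ s - ρ (s - h)| * (r / 2) := by
        refine integral_mono (hi1.sub hi2) (hi3.mul_const _) fun s => ?_
        dsimp only
        rw [← sub_mul]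
        refine (le_abs_self _).trans ?_
        rw [abs_mul]
        exact mul_le_mul_of_nonneg_left (hG s) (abs_nonneg _)
    _ ≤ r / 2 * |h| * bvNorm ρ := by
        rw [integral_mul_const]
        nlinarith [integral_abs_sub_shift_le hρ.measurable hρ.boundedVariation h]

end Variation

/-! ### Translating finitely many independent variables. -/

section ProductMeasure

open Measure

variable {ι : Type*} [DecidableEq ι]

theorem measurable_update_prod (k : ι) :
    Measurable fun p : ℝ × (ι → ℝ) => Function.update p.2 k p.1 := by
  refine measurable_pi_iff.2 fun i => ?_
  by_cases hi : i = k
  · subst hi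
    simpa using measurable_fst
  · simp only [Function.update_of_ne hi]
    fun_prop

/-- Resampling one coordinate of an independent family does not change its law. -/
theorem map_update_prod_infinitePi (μ : Measure ℝ) [IsProbabilityMeasure μ] (k : ι) :
    (μ.prod (infinitePi fun _ : ι => μ)).map (fun p => Function.update p.2 k p.1)
      = infinitePi fun _ : ι => μ := by
  have hm := measurable_update_prod (ι := ι) k
  refine eq_infinitePi _ fun s t ht => ?_
  rw [map_apply hm (MeasurableSet.pi s.countable_toSet fun i _ => ht i)]
  by_cases hk : k ∈ s
  · have : (fun p : ℝ × (ι → ℝ) => Function.update p.2 k p.1) ⁻¹' (s : Set ι).pi t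
        = t k ×ˢ ((s.erase k : Finset ι) : Set ι).pi t := by
      ext p
      simp only [Set.mem_preimage, Set.mem_pi, Set.mem_prod, Finset.mem_coe, Finset.mem_erase]
      constructor
      · refine fun h => ⟨by simpa using h k hk, fun i hi => by simpa [hi.1] using h i hi.2⟩
      · rintro ⟨h1, h2⟩ i hi
        by_cases hik : i = k
        · subst hik; simpa using h1
        · simpa [hik] using h2 i ⟨hik, hi⟩
    rw [this, prod_prod, infinitePi_pi _ (fun i _ => ht i), Finset.mul_prod_erase s (fun i => μ (t i)) hk]
  · have : (fun p : ℝ × (ι → ℝ) => Function.update p.2 k p.1) ⁻¹' (s : Set ι).pi t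
        = Set.univ ×ˢ (s : Set ι).pi t := by
      ext p
      simp only [Set.mem_preimage, Set.mem_pi, Set.mem_prod, Finset.mem_coe, Set.mem_univ,
        true_and]
      refine forall₂_congr fun i hi => ?_
      have : i ≠ k := fun h => hk (h ▸ hi)
      simp [this]
    rw [this, prod_prod, measure_univ, one_mul, infinitePi_pi _ (fun i _ => ht i)]

theorem integral_infinitePi_update (μ : Measure ℝ) [IsProbabilityMeasure μ] (k : ι)
    {G : (ι → ℝ) → ℝ} (hG : Measurable G) {C : ℝ} (hC : ∀ ω, |G ω| ≤ C) :
    ∫ ω, G ω ∂(infinitePi fun _ : ι => μ)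
      = ∫ ω, ∫ s, G (Function.update ω k s) ∂μ ∂(infinitePi fun _ : ι => μ) := by
  have hm := measurable_update_prod (ι := ι) k
  conv_lhs => rw [← map_update_prod_infinitePi μ k]
  rw [integral_map hm.aemeasurable hG.aestronglyMeasurable,
    integral_prod_symm (fun p : ℝ × (ι → ℝ) => G (Function.update p.2 k p.1))
      (integrable_of_bound (hG.comp hm) fun _ => hC _)]

/-- Change of the mean under a translation of one of the independent variables. -/
theorem IsBVDensity.integral_sub_shift_single_le {μ : Measure ℝ} [IsProbabilityMeasure μ]
    {ρ : ℝ → ℝ} (hρ : IsBVDensity μ ρ) {G : (ι → ℝ) → ℝ} (hG : Measurable G) {C : ℝ}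
    (hC : ∀ ω, |G ω| ≤ C) (k : ι) {r : ℝ}
    (hr : ∀ ω s t, G (Function.update ω k s) - G (Function.update ω k t) ≤ r) (h : ℝ) :
    ∫ ω, G ω ∂(infinitePi fun _ : ι => μ)
      - ∫ ω, G (ω + Pi.single k h) ∂(infinitePi fun _ : ι => μ) ≤ r / 2 * |h| * bvNorm ρ := by
  have hGs : Measurable fun ω : ι → ℝ => G (ω + Pi.single k h) :=
    hG.comp (measurable_id.add_const _)
  have hupd : ∀ (ω : ι → ℝ) (s : ℝ), Function.update ω k s + Pi.single k h = Function.update ω k (s + h) := by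
    intro ω s
    ext i
    by_cases hi : i = k
    · subst hi; simp
    · simp [hi]
  have hm := (measurable_update_prod (ι := ι) k).comp measurable_swap
  have hint : ∀ (G : (ι → ℝ) → ℝ), Measurable G → (∀ ω, |G ω| ≤ C) →
      Integrable (fun ω => ∫ s, G (Function.update ω k s) ∂μ) (infinitePi fun _ : ι => μ) :=
    fun G hG hC => (integrable_of_bound (P := (infinitePi fun _ : ι => μ).prod μ)
      (hG.comp hm) fun _ => hC _).integral_prod_left
  rw [integral_infinitePi_update μ k hG hC, integral_infinitePi_update μ k hGs fun _ => hC _,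
    ← integral_sub (hint _ hG hC) (hint _ hGs fun _ => hC _)]
  calc _ ≤ ∫ _ω, r / 2 * |h| * bvNorm ρ ∂(infinitePi fun _ : ι => μ) := by
        refine integral_mono ((hint _ hG hC).sub (hint _ hGs fun _ => hC _))
          (integrable_const _) fun ω => ?_
        simp only [hupd]
        exact hρ.integral_sub_shift_le (hG.comp (measurable_update ω)) (hr ω) h
    _ = _ := by simp

/-- Change of the mean under a translation of finitely many independent variables. -/
theorem IsBVDensity.integral_sub_shift_sum_le {μ : Measure ℝ} [IsProbabilityMeasure μ]
    {ρ : ℝ → ℝ} (hρ : IsBVDensity μ ρ) (S : Finset ι) (h : ι → ℝ) {C r : ℝ}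
    {G : (ι → ℝ) → ℝ} (hG : Measurable G) (hC : ∀ ω, |G ω| ≤ C)
    (hr : ∀ k ∈ S, ∀ ω s t, G (Function.update ω k s) - G (Function.update ω k t) ≤ r) :
    ∫ ω, G ω ∂(infinitePi fun _ : ι => μ)
      - ∫ ω, G (ω + ∑ k ∈ S, Pi.single k (h k)) ∂(infinitePi fun _ : ι => μ)
      ≤ r / 2 * (∑ k ∈ S, |h k|) * bvNorm ρ := by
  induction S using Finset.induction_on with
  | empty => simp
  | insert k S hk ih =>
    have ih := ih fun j hj => hr j (Finset.mem_insert_of_mem hj)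
    have hupd : ∀ (ω : ι → ℝ) (s : ℝ), Function.update ω k s + ∑ j ∈ S, Pi.single j (h j)
        = Function.update (ω + ∑ j ∈ S, Pi.single j (h j)) k s := by
      intro ω s
      ext i
      by_cases hi : i = k
      · subst hi
        simp only [Pi.add_apply, Function.update_self, Finset.sum_apply]
        rw [Finset.sum_eq_zero, add_zero]
        intro j hj
        exact Pi.single_eq_of_ne (fun e => hk (by rwa [e])) _
      · simp [hi]
    -- Telescoping: the variables in `S` are already shifted, and the shift of `k` acts on the
    -- shifted function. Its oscillation in the variable `k` is unchanged because `k ∉ S`.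
    have hstep := hρ.integral_sub_shift_single_le
      (G := fun ω => G (ω + ∑ j ∈ S, Pi.single j (h j))) (hG.comp (measurable_id.add_const _))
      (fun ω => hC _) k (r := r)
      (fun ω s t => by
        simp only [hupd]
        exact hr k (Finset.mem_insert_self _ _) _ s t) (h k)
    simp only [Finset.sum_insert hk]
    have hrw : ∀ ω : ι → ℝ, ω + (Pi.single k (h k) + ∑ j ∈ S, Pi.single j (h j))
        = ω + Pi.single k (h k) + ∑ j ∈ S, Pi.single j (h j) := fun ω => (add_assoc _ _ _).symm
    simp only [hrw]
    nlinarith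

end ProductMeasure

/-! ### The general Wegner estimate from a positive combination of translates. -/

section Wegner

open Matrix Filter Topology

/-- This holds on all configurations, including those where the series diverges and `tsum` takes its
default value. -/
theorem potential_measurable (u : (Fin d → ℤ) → ℝ) (x : Fin d → ℤ) :
    Measurable fun ω : (Fin d → ℤ) → ℝ => potential u ω x :=
  Measurable.tsum fun k => (measurable_pi_apply k).mul_const _

/-- The two series agree term by term, so convergence plays no role and the oscillation bound is
available for every `ω`. -/
theorem potential_update_of_eq_zero {u : (Fin d → ℤ) → ℝ} {x k : Fin d → ℤ} (h : u (x - k) = 0)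
    (ω : (Fin d → ℤ) → ℝ) (s : ℝ) : potential u (Function.update ω k s) x = potential u ω x := by
  refine tsum_congr fun j => ?_
  by_cases hj : j = k
  · subst hj; simp [h]
  · rw [Function.update_of_ne hj]

theorem potential_add_sum_single {u ω : (Fin d → ℤ) → ℝ} {x : Fin d → ℤ}
    (hs : Summable fun k => ω k * u (x - k)) (S : Finset (Fin d → ℤ)) (h : (Fin d → ℤ) → ℝ) :
    potential u (ω + ∑ k ∈ S, Pi.single k (h k)) x
      = potential u ω x + ∑ k ∈ S, h k * u (x - k) := by
  have h1 : ∀ j, (∑ k ∈ S, Pi.single k (h k)) j = if j ∈ S then h j else 0 := by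
    intro j
    simp [Finset.sum_apply, Pi.single_apply]
  have h2 : ∀ j ∉ S, (∑ k ∈ S, Pi.single k (h k)) j * u (x - j) = 0 := by
    intro j hj
    rw [h1, if_neg hj, zero_mul]
  have h3 : (∑ k ∈ S, h k * u (x - k))
      = ∑' j, (∑ k ∈ S, Pi.single k (h k)) j * u (x - j) := by
    rw [tsum_eq_sum h2]
    refine Finset.sum_congr rfl fun j hj => ?_
    rw [h1, if_pos hj]
  rw [h3, potential, potential, ← hs.tsum_add (summable_of_ne_finset_zero h2)]
  refine tsum_congr fun j => ?_
  rw [Pi.add_apply, add_mul]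

/-- The kinetic part of the restricted operator. -/
def kinetic (d L : ℕ) : Matrix (cube d L) (cube d L) ℂ := restricted 0 0 L 0

theorem kinetic_isHermitian (d L : ℕ) : (kinetic d L).IsHermitian :=
  restricted_isHermitian _ _ _ _

theorem restricted_eq (u : (Fin d → ℤ) → ℝ) (lam : ℝ) (L : ℕ) (ω : (Fin d → ℤ) → ℝ) :
    restricted u lam L ω
      = kinetic d L + diagonal (fun p : cube d L => ((lam * potential u ω p : ℝ) : ℂ)) := by
  ext x y
  simp only [kinetic, restricted, hamiltonian, Matrix.add_apply, Matrix.of_apply, zero_mul,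
    Complex.ofReal_zero, add_zero]
  congr 1
  by_cases hxy : x = y
  · subst hxy; simp
  · rw [Matrix.diagonal_apply_ne _ hxy, Pi.single_eq_of_ne (fun h => hxy (Subtype.ext h)),
      mul_zero]

/-- The integrated density of states of `H_{ω,L}`, without normalization. -/
def stateCount (u : (Fin d → ℤ) → ℝ) (lam : ℝ) (L : ℕ) (E : ℝ) (ω : (Fin d → ℤ) → ℝ) : ℕ :=
  levelCount (kinetic_isHermitian d L) (fun p => lam * potential u ω p) E

theorem stateCount_measurable (u : (Fin d → ℤ) → ℝ) (lam : ℝ) (L : ℕ) (E : ℝ) :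
    Measurable fun ω => (stateCount u lam L E ω : ℝ) := by
  refine (measurable_from_top (f := fun n : ℕ => (n : ℝ))).comp
    ((measurable_levelCount (kinetic_isHermitian d L) E).comp ?_)
  exact measurable_pi_iff.2 fun p => (potential_measurable u p).const_mul lam

theorem stateCount_eq (u : (Fin d → ℤ) → ℝ) (lam : ℝ) (L : ℕ) (E : ℝ) (ω : (Fin d → ℤ) → ℝ) :
    stateCount u lam L E ω = eigenCount (restricted_isHermitian u lam L ω) (Set.Iic E) := by
  simp only [stateCount, levelCount]
  congr 1
  exact (restricted_eq u lam L ω).symm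

theorem stateCount_le (u : (Fin d → ℤ) → ℝ) (lam : ℝ) (L : ℕ) (E : ℝ) (ω : (Fin d → ℤ) → ℝ) :
    stateCount u lam L E ω ≤ Fintype.card (cube d L) :=
  levelCount_le_card _ _ _

theorem spectralTrace_eq (u : (Fin d → ℤ) → ℝ) (lam : ℝ) (L : ℕ) (a b : ℝ) (hab : a ≤ b)
    (ω : (Fin d → ℤ) → ℝ) :
    spectralTrace u lam L (Set.Icc a b) ω = stateCount u lam L b ω
      - eigenCount (restricted_isHermitian u lam L ω) (Set.Iio a) := by
  have hsub : Set.Iio a ⊆ Set.Iic b := fun x hx => (le_of_lt hx).trans hab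
  rw [spectralTrace, trace_cfc_indicator (restricted_isHermitian u lam L ω), stateCount_eq,
    ← eigenCount_sdiff _ hsub]
  congr 2
  ext x
  simp

/-- For fixed `ω` the sequence is eventually constant, as there is a gap just below `a`. It exhibits
the spectral trace as a pointwise limit of measurable functions. -/
theorem spectralTrace_tendsto (u : (Fin d → ℤ) → ℝ) (lam : ℝ) (L : ℕ) (a b : ℝ) (hab : a ≤ b)
    (ω : (Fin d → ℤ) → ℝ) :
    Tendsto (fun n : ℕ => (stateCount u lam L b ω : ℝ)
        - stateCount u lam L (a - 1 / ((n : ℝ) + 1)) ω) atTop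
      (𝓝 (spectralTrace u lam L (Set.Icc a b) ω)) := by
  have h0 : Tendsto (fun n : ℕ => 1 / ((n : ℝ) + 1)) atTop (𝓝[>] 0) :=
    tendsto_nhdsWithin_iff.2 ⟨tendsto_one_div_add_atTop_nhds_zero_nat,
      Eventually.of_forall fun n => Set.mem_Ioi.2 (by positivity)⟩
  refine tendsto_const_nhds.congr' ?_
  filter_upwards [h0.eventually
    (eventually_eigenCount_Iic_sub (restricted_isHermitian u lam L ω) a)] with n hn
  rw [spectralTrace_eq u lam L a b hab, stateCount_eq u lam L (a - _), hn]

theorem spectralTrace_measurable (u : (Fin d → ℤ) → ℝ) (lam : ℝ) (L : ℕ) (a b : ℝ)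
    (hab : a ≤ b) : Measurable (spectralTrace u lam L (Set.Icc a b)) :=
  measurable_of_tendsto_metrizable
    (fun n => (stateCount_measurable u lam L b).sub
      (stateCount_measurable u lam L (a - 1 / ((n : ℝ) + 1))))
    (tendsto_pi_nhds.2 fun ω => spectralTrace_tendsto u lam L a b hab ω)

theorem spectralTrace_nonneg (u : (Fin d → ℤ) → ℝ) (lam : ℝ) (L : ℕ) (I : Set ℝ)
    (ω : (Fin d → ℤ) → ℝ) : 0 ≤ spectralTrace u lam L I ω := by
  rw [spectralTrace, trace_cfc_indicator (restricted_isHermitian u lam L ω)]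
  positivity

theorem spectralTrace_le (u : (Fin d → ℤ) → ℝ) (lam : ℝ) (L : ℕ) {a b a' : ℝ} (hab : a ≤ b)
    (ha : a' < a) (ω : (Fin d → ℤ) → ℝ) :
    spectralTrace u lam L (Set.Icc a b) ω
      ≤ stateCount u lam L b ω - stateCount u lam L a' ω := by
  rw [spectralTrace_eq u lam L a b hab, stateCount_eq u lam L a']
  gcongr
  exact eigenCount_mono _ fun x hx => lt_of_le_of_lt hx ha

/-- A Wegner estimate for potentials such that a linear combination of finitely many translates of
the single site potential is bounded below on the cube by a positive constant. -/
theorem wegnerBound_of_covering {u : (Fin d → ℤ) → ℝ} {μ : Measure ℝ} [IsProbabilityMeasure μ]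
    {ρ : ℝ → ℝ} (hρ : IsBVDensity μ ρ) {L : ℕ}
    (S : Finset (Fin d → ℤ)) (a : (Fin d → ℤ) → ℝ) {δ : ℝ} (hδ : 0 < δ)
    (hcov : ∀ x ∈ cube d L, δ ≤ ∑ k ∈ S, a k * u (x - k)) (r : ℕ)
    (hr : ∀ k ∈ S, ((cube d L).filter fun x => u (x - k) ≠ 0).card ≤ r)
    (hae : ∀ᵐ ω ∂couplingLaw d μ, ∀ x, Summable fun k => ω k * u (x - k))
    {lam : ℝ} (hlam : 0 < lam) (E : ℝ) {ε : ℝ} (hε : 0 < ε) :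
    WegnerBound u lam μ L E ε (ε / (lam * δ) * (∑ k ∈ S, |a k|) * r * bvNorm ρ) := by
  have : IsProbabilityMeasure (couplingLaw d μ) := by unfold couplingLaw; infer_instance
  have hab : E - ε ≤ E + ε := by linarith
  have hcount : ∀ b ω, |(stateCount u lam L b ω : ℝ)| ≤ Fintype.card (cube d L) := by
    intro b ω
    rw [abs_of_nonneg (by positivity)]
    exact_mod_cast stateCount_le u lam L b ω
  have hint : ∀ b, Integrable (fun ω => (stateCount u lam L b ω : ℝ)) (couplingLaw d μ) :=
    fun b => integrable_of_bound (stateCount_measurable u lam L b) (hcount b)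
  have hi : Integrable (spectralTrace u lam L (Set.Icc (E - ε) (E + ε))) (couplingLaw d μ) := by
    refine integrable_of_bound (C := Fintype.card (cube d L))
      (spectralTrace_measurable u lam L _ _ hab) fun ω => ?_
    rw [abs_of_nonneg (spectralTrace_nonneg ..), spectralTrace_eq u lam L _ _ hab]
    have := (le_abs_self _).trans (hcount (E + ε) ω)
    have h2 : (0 : ℝ) ≤ (eigenCount (restricted_isHermitian u lam L ω) (Set.Iio (E - ε)) : ℝ) := by
      positivity
    linarith
  refine ⟨hi, ?_⟩
  -- The window is closed at `E - ε`, so it is enlarged downwards by `η`, which tends to zero at the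
  -- end.
  have key : ∀ η : ℝ, 0 < η →
      ∫ ω, spectralTrace u lam L (Set.Icc (E - ε) (E + ε)) ω ∂couplingLaw d μ
        ≤ (2 * ε + η) / (2 * (lam * δ)) * (∑ k ∈ S, |a k|) * r * bvNorm ρ := by
    intro η hη
    -- Chosen so that the shift `t a` raises `lam V_ω` on the cube by at least the length `2ε + η`
    -- of the enlarged window.
    set t := (2 * ε + η) / (lam * δ) with ht
    have ht0 : 0 < t := by positivity
    set G : ((Fin d → ℤ) → ℝ) → ℝ := fun ω => stateCount u lam L (E + ε) ω with hG
    have hGm : Measurable G := stateCount_measurable u lam L (E + ε)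
    have hosc : ∀ k ∈ S, ∀ ω s s', G (Function.update ω k s) - G (Function.update ω k s') ≤ r := by
      intro k hk ω s s'
      have h1 := levelCount_le_add_card (kinetic_isHermitian d L)
        (v := fun p => lam * potential u (Function.update ω k s) p)
        (w := fun p => lam * potential u (Function.update ω k s') p) (E := E + ε) (E' := E + ε)
        (Finset.univ.filter fun p : cube d L => u (p - k) ≠ 0) fun p hp => by
          have hp : u (p - k) = 0 := by simpa using hp
          rw [potential_update_of_eq_zero hp, potential_update_of_eq_zero hp]
      have h2 : (Finset.univ.filter fun p : cube d L => u (p - k) ≠ 0).card ≤ r := by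
        refine le_trans (le_of_eq ?_) (hr k hk)
        rw [← Finset.card_map (Function.Embedding.subtype _)]
        congr 1
        ext x
        simp [and_comm]
      have h3 := h1.trans (Nat.add_le_add_left h2 _)
      have h4 : (stateCount u lam L (E + ε) (Function.update ω k s) : ℝ)
          ≤ stateCount u lam L (E + ε) (Function.update ω k s') + r := by exact_mod_cast h3
      simp only [hG]
      linarith
    have hshift := hρ.integral_sub_shift_sum_le S (fun k => t * a k) hGm (hcount (E + ε)) hosc
    -- Only almost sure: the potential is additive under the shift where its defining series
    -- converges.
    have hle : ∀ᵐ ω ∂couplingLaw d μ, spectralTrace u lam L (Set.Icc (E - ε) (E + ε)) ω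
        ≤ G ω - G (ω + ∑ k ∈ S, Pi.single k (t * a k)) := by
      filter_upwards [hae] with ω hω
      refine (spectralTrace_le u lam L hab (show E - ε - η < E - ε by linarith) ω).trans ?_
      refine sub_le_sub_left (Nat.cast_le.2 ?_) _
      refine levelCount_le (kinetic_isHermitian d L) fun p => ?_
      rw [potential_add_sum_single (hω p)]
      have h1 := hcov p p.2
      have h2 : ∑ k ∈ S, t * a k * u (p - k) = t * ∑ k ∈ S, a k * u (p - k) := by
        rw [Finset.mul_sum]
        exact Finset.sum_congr rfl fun k _ => mul_assoc _ _ _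
      have h3 : lam * (t * δ) = 2 * ε + η := by
        rw [ht]
        field_simp
      have h4 : lam * (t * δ) ≤ lam * (t * ∑ k ∈ S, a k * u (p - k)) := by gcongr
      rw [h2, mul_add]
      linarith
    have hi2 : Integrable (fun ω => G (ω + ∑ k ∈ S, Pi.single k (t * a k))) (couplingLaw d μ) :=
      integrable_of_bound (hGm.comp (measurable_id.add_const _)) fun _ => hcount _ _
    have h5 := integral_mono_ae hi ((hint _).sub hi2) hle
    refine h5.trans (le_trans (le_of_eq (integral_sub (hint _) hi2)) (hshift.trans (le_of_eq ?_)))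
    simp only [abs_mul, abs_of_pos ht0, ← Finset.mul_sum]
    rw [ht]
    field_simp
  have hlim : Tendsto (fun η : ℝ => (2 * ε + η) / (2 * (lam * δ)) * (∑ k ∈ S, |a k|) * r * bvNorm ρ)
      (𝓝[>] 0) (𝓝 ((2 * ε + 0) / (2 * (lam * δ)) * (∑ k ∈ S, |a k|) * r * bvNorm ρ)) := by
    refine Tendsto.mono_left (Continuous.tendsto ?_ 0) nhdsWithin_le_nhds
    fun_prop
  refine (ge_of_tendsto hlim (eventually_mem_nhdsWithin.mono fun η hη => key η hη)).trans
    (le_of_eq ?_)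
  rw [add_zero, mul_div_mul_left _ _ two_ne_zero]

theorem WegnerBound.mono {u : (Fin d → ℤ) → ℝ} {lam : ℝ} {μ : Measure ℝ} [IsProbabilityMeasure μ]
    {L : ℕ} {E ε K K' : ℝ} (h : WegnerBound u lam μ L E ε K) (hK : K ≤ K') :
    WegnerBound u lam μ L E ε K' :=
  ⟨h.1, h.2.trans hK⟩

/-- Coupling constants with a bounded density are almost surely uniformly bounded. -/
theorem ae_summable_of_isBounded_support {u : (Fin d → ℤ) → ℝ} (hu : Summable u) {μ : Measure ℝ}
    [IsProbabilityMeasure μ] {ρ : ℝ → ℝ} (hρ : IsBVDensity μ ρ)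
    (hb : Bornology.IsBounded (Function.support ρ)) :
    ∀ᵐ ω ∂couplingLaw d μ, ∀ x, Summable fun k => ω k * u (x - k) := by
  obtain ⟨R, hR⟩ := hb.exists_norm_le
  have h1 : ∀ᵐ s ∂μ, |s| ≤ R := by
    rw [hρ.eq_withDensity, ae_withDensity_iff hρ.measurable.ennreal_ofReal]
    refine Eventually.of_forall fun s hs => hR s fun h => hs ?_
    rw [h, ENNReal.ofReal_zero]
  have h2 : ∀ᵐ ω ∂couplingLaw d μ, ∀ k, |ω k| ≤ R := by
    rw [ae_all_iff]
    intro k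
    exact (measurePreserving_eval_infinitePi (fun _ : Fin d → ℤ => μ) k).quasiMeasurePreserving.ae h1
  filter_upwards [h2] with ω hω x
  have h3 : Summable fun k => u (x - k) := (Equiv.subLeft x).summable_iff.2 hu
  refine Summable.of_norm_bounded (h3.abs.mul_left R) fun k => ?_
  rw [Real.norm_eq_abs, abs_mul]
  exact mul_le_mul_of_nonneg_right (hω k) (abs_nonneg _)

theorem summable_coupling_of_finite_support {u : (Fin d → ℤ) → ℝ} (hu : (Function.support u).Finite)
    (ω : (Fin d → ℤ) → ℝ) (x : Fin d → ℤ) : Summable fun k => ω k * u (x - k) := by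
  refine summable_of_hasFiniteSupport ((hu.preimage (f := fun k => x - k)
    sub_right_injective.injOn).subset fun k hk => ?_)
  exact right_ne_zero_of_mul hk

theorem card_filter_le_card_cube (u : (Fin d → ℤ) → ℝ) (L : ℕ) (k : Fin d → ℤ) :
    ((cube d L).filter fun x => u (x - k) ≠ 0).card ≤ (2 * L + 1) ^ d := by
  refine (Finset.card_filter_le _ _).trans (le_of_eq ?_)
  rw [cube, Pi.card_Icc]
  simp only [Int.card_Icc, Finset.prod_const, Finset.card_univ, Fintype.card_fin]
  congr 1
  omega

theorem card_filter_le_encard_support (u : (Fin d → ℤ) → ℝ) (L : ℕ) (k : Fin d → ℤ) :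
    ((((cube d L).filter fun x => u (x - k) ≠ 0).card : ℕ) : ℕ∞) ≤ (Function.support u).encard := by
  rw [← Set.encard_coe_eq_coe_finsetCard]
  refine Set.encard_le_encard_of_injOn (f := fun x => x - k) (fun x hx => ?_)
    sub_left_injective.injOn
  simp only [Finset.coe_filter, Set.mem_ofPred_eq] at hx
  exact hx.2

end Wegner

/-! ### Counting lattice points near a cube. -/

section LatticeCounting

/-- The points of the lattice at `ℓ¹` distance at most `r` from the cube `Λ_L`. -/
def cubeNhd (d L r : ℕ) : Finset (Fin d → ℤ) :=
  (cube d (L + r)).filter fun k => ∑ i, ((k i).natAbs - L) ≤ r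

theorem mem_cube {L : ℕ} {k : Fin d → ℤ} : k ∈ cube d L ↔ ∀ i, (k i).natAbs ≤ L := by
  simp only [cube, Finset.mem_Icc, Pi.le_def, ← forall_and]
  exact forall_congr' fun i => by omega

theorem mem_cubeNhd {L r : ℕ} {k : Fin d → ℤ} :
    k ∈ cubeNhd d L r ↔ ∑ i, ((k i).natAbs - L) ≤ r := by
  rw [cubeNhd, Finset.mem_filter, and_iff_right_iff_imp, mem_cube]
  intro h i
  have := Finset.single_le_sum (f := fun i => (k i).natAbs - L) (fun _ _ => Nat.zero_le _)
    (Finset.mem_univ i)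
  omega

/-- Truncated subtraction makes `j.natAbs - L` the distance from `j` to `[-L, L]`: it is zero at `2L
+ 1` integers, and each positive value is taken at two integers. -/
theorem sum_Icc_natAbs_sub (L : ℕ) (f : ℕ → ℕ) (r : ℕ) :
    ∑ j ∈ Finset.Icc (-((L + r : ℕ) : ℤ)) ((L + r : ℕ) : ℤ), f (j.natAbs - L)
      = (2 * L + 1) * f 0 + 2 * ∑ i ∈ Finset.range r, f (i + 1) := by
  induction r with
  | zero =>
    rw [Finset.sum_congr rfl (g := fun _ => f 0), Finset.sum_const, Int.card_Icc]
    · simp only [Finset.range_zero, Finset.sum_empty, smul_eq_mul, mul_zero, add_zero]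
      congr 1
      omega
    · intro j hj
      rw [Finset.mem_Icc] at hj
      congr 1
      omega
  | succ r ih =>
    have h1 : Finset.Icc (-((L + (r + 1) : ℕ) : ℤ)) ((L + (r + 1) : ℕ) : ℤ)
        = insert (-((L + (r + 1) : ℕ) : ℤ)) (insert ((L + (r + 1) : ℕ) : ℤ)
          (Finset.Icc (-((L + r : ℕ) : ℤ)) ((L + r : ℕ) : ℤ))) := by
      ext j
      simp only [Finset.mem_Icc, Finset.mem_insert]
      omega
    rw [h1, Finset.sum_insert, Finset.sum_insert, ih, Finset.sum_range_succ]
    · have h2 : (-((L + (r + 1) : ℕ) : ℤ)).natAbs - L = r + 1 := by omega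
      have h3 : (((L + (r + 1) : ℕ) : ℤ)).natAbs - L = r + 1 := by omega
      rw [h2, h3]
      ring
    · simp only [Finset.mem_Icc]
      omega
    · simp only [Finset.mem_Icc, Finset.mem_insert]
      omega

/-- Slicing by the first coordinate: a slice at distance `i` from `[-L, L]` leaves radius `r - i`
for the other coordinates. -/
theorem card_cubeNhd_succ_le (d L r : ℕ) :
    (cubeNhd (d + 1) L r).card ≤ (2 * L + 1) * (cubeNhd d L r).card
      + 2 * ∑ i ∈ Finset.range r, (cubeNhd d L (r - (i + 1))).card := by
  have h0 : (cubeNhd d L r).card = (cubeNhd d L (r - 0)).card := rfl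
  rw [h0, ← sum_Icc_natAbs_sub L (fun i => (cubeNhd d L (r - i)).card) r]
  rw [Finset.card_eq_sum_card_fiberwise (f := fun k : Fin (d + 1) → ℤ => k 0)
    (t := Finset.Icc (-((L + r : ℕ) : ℤ)) ((L + r : ℕ) : ℤ))]
  · refine Finset.sum_le_sum fun j _ => ?_
    refine Finset.card_le_card_of_injOn Fin.tail (fun k hk => ?_) fun k hk k' hk' h => ?_
    · rw [Finset.mem_coe, Finset.mem_filter, mem_cubeNhd, Fin.sum_univ_succ] at hk
      rw [Finset.mem_coe, mem_cubeNhd]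
      obtain ⟨h1, rfl⟩ := hk
      have : ∑ i, ((Fin.tail k i).natAbs - L) = ∑ i : Fin d, ((k i.succ).natAbs - L) := rfl
      omega
    · rw [Finset.mem_coe, Finset.mem_filter] at hk hk'
      rw [← Fin.cons_self_tail k, ← Fin.cons_self_tail k', h, hk.2, hk'.2]
  · intro k hk
    rw [Finset.mem_coe, cubeNhd, Finset.mem_filter, mem_cube] at hk
    have := hk.1 0
    change k 0 ∈ Finset.Icc (-((L + r : ℕ) : ℤ)) ((L + r : ℕ) : ℤ)
    rw [Finset.mem_Icc]
    omega

/-- Convexity of `x ↦ x ^ d`: spreading two points apart with fixed sum increases the sum of the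
values. -/
theorem pow_add_pow_le_pow_add_pow (M i j d : ℕ) :
    (M + i) ^ d + (M + j) ^ d ≤ M ^ d + (M + i + j) ^ d := by
  induction d with
  | zero => simp
  | succ d ih =>
    have h1 : (M + i) ^ d ≤ (M + i + j) ^ d := Nat.pow_le_pow_left (by omega) _
    have h2 : (M + j) ^ d ≤ (M + i + j) ^ d := Nat.pow_le_pow_left (by omega) _
    simp only [pow_succ]
    generalize (M + i + j) ^ d = D at *
    generalize (M + i) ^ d = A at *
    generalize (M + j) ^ d = B at *
    generalize M ^ d = C at *
    linarith [Nat.mul_le_mul_left M ih, Nat.mul_le_mul_left i h1, Nat.mul_le_mul_left j h2]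

/-- A trapezoid bound: pair each term with its reflection and apply convexity to the pair. -/
theorem two_mul_sum_pow_le (M r d : ℕ) :
    2 * ∑ i ∈ Finset.range r, (M + (r - (i + 1))) ^ d ≤ r * (M ^ d + (M + r) ^ d) := by
  have h1 : ∑ i ∈ Finset.range r, (M + (r - (i + 1))) ^ d = ∑ i ∈ Finset.range r, (M + i) ^ d := by
    rw [← Finset.sum_range_reflect]
    refine Finset.sum_congr rfl fun i hi => ?_
    rw [Finset.mem_range] at hi
    congr 2
    omega
  rw [two_mul]
  nth_rewrite 2 [h1]
  rw [← Finset.sum_add_distrib]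
  have h2 : ∀ i ∈ Finset.range r, (M + (r - (i + 1))) ^ d + (M + i) ^ d
      ≤ M ^ d + (M + r) ^ d := by
    intro i hi
    rw [Finset.mem_range] at hi
    calc (M + (r - (i + 1))) ^ d + (M + i) ^ d
        ≤ M ^ d + (M + (r - (i + 1)) + i) ^ d := pow_add_pow_le_pow_add_pow _ _ _ _
      _ ≤ M ^ d + (M + r) ^ d := by
          refine Nat.add_le_add_left (Nat.pow_le_pow_left ?_ _) _
          omega
  have h3 := Finset.sum_le_sum h2
  rwa [Finset.sum_const, Finset.card_range, smul_eq_mul] at h3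

/-- The number of lattice points at `ℓ¹` distance at most `r` from the cube. -/
theorem card_cubeNhd_add_le (d L r : ℕ) :
    (cubeNhd d L r).card + (2 * L + 1) ^ d ≤ 2 * (2 * L + 1 + r) ^ d := by
  -- The extra term `(2L + 1) ^ d` on the left is what closes the induction: summed over the slices,
  -- it cancels the lower endpoint `M ^ d` of the trapezoid bound.
  induction d generalizing r with
  | zero =>
    have : (cubeNhd 0 L r).card ≤ 1 := Finset.card_le_one_of_subsingleton _
    simpa using this
  | succ d ih =>
    have h1 := card_cubeNhd_succ_le d L r
    generalize 2 * L + 1 = M at *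
    have h2 := Nat.mul_le_mul_left M (ih r)
    have h3 : ∑ i ∈ Finset.range r, (cubeNhd d L (r - (i + 1))).card + r * M ^ d
        ≤ 2 * ∑ i ∈ Finset.range r, (M + (r - (i + 1))) ^ d := by
      have : r * M ^ d = ∑ i ∈ Finset.range r, M ^ d := by simp
      rw [this, ← Finset.sum_add_distrib, Finset.mul_sum]
      exact Finset.sum_le_sum fun i _ => ih _
    have h4 := two_mul_sum_pow_le M r d
    generalize ∑ i ∈ Finset.range r, (M + (r - (i + 1))) ^ d = P at *
    generalize ∑ i ∈ Finset.range r, (cubeNhd d L (r - (i + 1))).card = Q at *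
    simp only [pow_succ]
    linarith

theorem le_l1norm_sub_of_notMem_cubeNhd {L r : ℕ} {x k : Fin d → ℤ} (hx : x ∈ cube d L)
    (hk : k ∉ cubeNhd d L r) : ((r + 1 : ℕ) : ℤ) ≤ l1norm (x - k) := by
  rw [mem_cubeNhd, not_le] at hk
  rw [mem_cube] at hx
  have h1 : ∑ i, ((k i).natAbs - L) ≤ ∑ i, (x i - k i).natAbs :=
    Finset.sum_le_sum fun i _ => by have := hx i; omega
  have h2 : l1norm (x - k) = ((∑ i, (x i - k i).natAbs : ℕ) : ℤ) := by
    rw [l1norm]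
    push_cast
    rfl
  rw [h2]
  exact_mod_cast hk.trans_le h1

/-- Bernoulli: `(1 - 1/(2L+1)) ^ d ≥ 1 - d/(2L+1) ≥ 1/2`. -/
theorem two_mul_add_one_pow_le {L : ℕ} (hL : 1 ≤ L) (h : d ≤ L) :
    (2 * L + 1) ^ d ≤ 2 * (2 * L) ^ d := by
  have hL' : (1 : ℝ) ≤ L := by exact_mod_cast hL
  have hd' : (d : ℝ) ≤ L := by exact_mod_cast h
  have hp : (0 : ℝ) < 2 * L + 1 := by positivity
  have h1 := one_add_mul_le_pow (a := -1 / (2 * (L : ℝ) + 1)) (by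
    rw [le_div_iff₀ hp]; nlinarith) d
  have h2 : 1 + -1 / (2 * (L : ℝ) + 1) = 2 * L / (2 * L + 1) := by field_simp; ring
  have h3 : (1 : ℝ) / 2 ≤ 1 + d * (-1 / (2 * (L : ℝ) + 1)) := by
    have : (d : ℝ) * (-1 / (2 * (L : ℝ) + 1)) = -(d / (2 * L + 1)) := by ring
    rw [this]
    have : (d : ℝ) / (2 * L + 1) ≤ 1 / 2 := by rw [div_le_div_iff₀ hp two_pos]; nlinarith
    linarith
  have h4 := h3.trans h1
  rw [h2, div_pow, div_le_div_iff₀ two_pos (by positivity)] at h4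
  have : ((2 * L + 1 : ℕ) : ℝ) ^ d ≤ 2 * ((2 * L : ℕ) : ℝ) ^ d := by push_cast; linarith
  exact_mod_cast this

theorem le_minSupp {u : (Fin d → ℤ) → ℝ} {M n : ℕ} (h1 : n ≤ M)
    (h2 : (n : ℕ∞) ≤ (Function.support u).encard) : n ≤ minSupp u M := by
  have h3 : (n : ℕ∞) ≤ min (M : ℕ∞) (Function.support u).encard :=
    le_min (by exact_mod_cast h1) h2
  have h4 : min (M : ℕ∞) (Function.support u).encard ≠ ⊤ :=
    ne_top_of_le_ne_top (ENat.natCast_ne_top M) (min_le_left _ _)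
  exact ENat.toNat_le_toNat h3 h4

theorem minSupp_le_two_mul (u : (Fin d → ℤ) → ℝ) {M N : ℕ} (h : M ≤ 2 * N) :
    minSupp u M ≤ 2 * minSupp u N := by
  unfold minSupp
  induction (Function.support u).encard using ENat.recTopCoe with
  | top => simpa using h
  | coe s =>
    have key : ∀ a : ℕ, (min (a : ℕ∞) (s : ℕ∞)).toNat = min a s := by
      intro a
      rcases le_total a s with h | h
      · rw [min_eq_left h, min_eq_left (by exact_mod_cast h), ENat.toNat_natCast]
      · rw [min_eq_right h, min_eq_right (by exact_mod_cast h), ENat.toNat_natCast]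
    rw [key, key]
    omega

end LatticeCounting

/-! ### Single site potentials of nonzero mean. -/

section NonzeroMean

theorem abs_sum_sub_tsum_le {β : Type*} [DecidableEq β] {f : β → ℝ} (hf : Summable f)
    (S : Finset β) {g : β → ℝ} (hg : Summable g) (hg0 : ∀ k ∈ S, 0 ≤ g k)
    (h : ∀ k ∉ S, |f k| ≤ g k) : |∑ k ∈ S, f k - ∑' k, f k| ≤ ∑' k, g k := by
  have hS : Summable fun k => if k ∈ S then f k else 0 :=
    summable_of_ne_finset_zero (s := S) fun k hk => if_neg hk
  have h1 : ∑ k ∈ S, f k = ∑' k, if k ∈ S then f k else 0 := by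
    rw [tsum_eq_sum (s := S) fun k hk => if_neg hk]
    exact Finset.sum_congr rfl fun k hk => (if_pos hk).symm
  rw [h1, ← hS.tsum_sub hf, ← Real.norm_eq_abs]
  refine tsum_of_norm_bounded hg.hasSum fun k => ?_
  by_cases hk : k ∈ S
  · simpa [hk] using hg0 k hk
  · simpa [hk] using h k hk

/-- The coefficients are the sign of the mean on the sites at `ℓ¹` distance at most `m - 1` from the
cube. The omitted terms sum to at most half the mean in absolute value, so `δ = |∑ u| / 2`; there
are at most `2 (2L + m) ^ d` sites, hence the constant 4. -/
theorem wegnerBound_of_tsum_ne_zero {u : (Fin d → ℤ) → ℝ} (hu : Summable u)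
    (hu0 : ∑' k, u k ≠ 0) {μ : Measure ℝ} [IsProbabilityMeasure μ] {ρ : ℝ → ℝ}
    (hρ : IsBVDensity μ ρ) (hsupp : HasCompactSupport ρ) {m : ℕ}
    (hm : (∑' k : {k : Fin d → ℤ | (m : ℤ) ≤ l1norm k}, |u k|) ≤ |(∑' k, u k) / 2|)
    {lam : ℝ} (hlam : 0 < lam) (L : ℕ) (E : ℝ) {ε : ℝ} (hε : 0 < ε) :
    WegnerBound u lam μ L E ε (4 / (lam * |∑' k, u k|) * (minSupp u ((2 * L + 1) ^ d) : ℝ) *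
      bvNorm ρ * ε * (2 * (L : ℝ) + m) ^ d) := by
  set ubar := ∑' k, u k with hubar
  have hpos : 0 < |ubar| := abs_pos.2 hu0
  have hbv : 0 ≤ bvNorm ρ := ENNReal.toReal_nonneg
  rw [tsum_subtype {k : Fin d → ℤ | (m : ℤ) ≤ l1norm k} (fun k => |u k|), abs_div, abs_two] at hm
  -- For `m = 0` the tail is the whole `ℓ¹` norm, which cannot be at most half of the nonzero `|∑
  -- u|`.
  have hm1 : 1 ≤ m := by
    by_contra h
    obtain rfl : m = 0 := by omega
    have h1 : {k : Fin d → ℤ | ((0 : ℕ) : ℤ) ≤ l1norm k} = Set.univ := by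
      ext k
      simp [l1norm, Finset.sum_nonneg]
    rw [h1, Set.indicator_univ] at hm
    have h2 : |ubar| ≤ ∑' k, |u k| := by
      simpa only [Real.norm_eq_abs] using norm_tsum_le_tsum_norm hu.norm
    linarith
  obtain ⟨r, rfl⟩ : ∃ r, m = r + 1 := ⟨m - 1, by omega⟩
  have hcov : ∀ x ∈ cube d L,
      |ubar| / 2 ≤ ∑ k ∈ cubeNhd d L r, (SignType.sign ubar : ℝ) * u (x - k) := by
    intro x hx
    set g : (Fin d → ℤ) → ℝ :=
      {k : Fin d → ℤ | ((r + 1 : ℕ) : ℤ) ≤ l1norm k}.indicator fun k => |u k| with hg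
    have hf' : Summable fun k => u (x - k) := (Equiv.subLeft x).summable_iff.2 hu
    have hg0 : ∀ k, 0 ≤ g k := fun k => Set.indicator_nonneg (fun j _ => abs_nonneg (u j)) k
    have hgs : Summable g := hu.abs.indicator _
    have hg' : Summable fun k => g (x - k) :=
      (Equiv.summable_iff (f := g) (Equiv.subLeft x)).2 hgs
    have hgk : ∀ k ∉ cubeNhd d L r, |u (x - k)| ≤ g (x - k) := by
      intro k hk
      have hmem : x - k ∈ {k : Fin d → ℤ | ((r + 1 : ℕ) : ℤ) ≤ l1norm k} :=
        le_l1norm_sub_of_notMem_cubeNhd hx hk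
      rw [hg, Set.indicator_of_mem hmem]
    have h1 := abs_sum_sub_tsum_le hf' (cubeNhd d L r) hg'
      (fun k _ => hg0 (x - k)) hgk
    have h2 : ∑' k, u (x - k) = ∑' k, u k := (Equiv.subLeft x).tsum_eq u
    have h3 : ∑' k, g (x - k) = ∑' k, g k := (Equiv.subLeft x).tsum_eq g
    rw [h2, h3, ← hubar] at h1
    have h4 := abs_le.1 (h1.trans hm)
    rw [← Finset.mul_sum]
    rcases lt_or_gt_of_ne hu0 with hneg | hneg
    · rw [sign_neg hneg]
      rw [abs_of_neg hneg] at h4 ⊢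
      simp only [SignType.coe_neg_one]
      linarith
    · rw [sign_pos hneg]
      rw [abs_of_pos hneg] at h4 ⊢
      simp only [SignType.coe_one]
      linarith
  have hsum : ∑ _k ∈ cubeNhd d L r, |(SignType.sign ubar : ℝ)| = (cubeNhd d L r).card := by
    rcases lt_or_gt_of_ne hu0 with hneg | hneg
    · simp [sign_neg hneg]
    · simp [sign_pos hneg]
  have hrank : ∀ k ∈ cubeNhd d L r, ((cube d L).filter fun x => u (x - k) ≠ 0).card
      ≤ minSupp u ((2 * L + 1) ^ d) := fun k _ =>
    le_minSupp (card_filter_le_card_cube u L k) (card_filter_le_encard_support u L k)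
  have hae : ∀ᵐ ω ∂couplingLaw d μ, ∀ x, Summable fun k => ω k * u (x - k) :=
    ae_summable_of_isBounded_support hu hρ
      (hsupp.isCompact.isBounded.subset (subset_tsupport ρ))
  have hbound := wegnerBound_of_covering hρ (cubeNhd d L r)
    (fun _ => (SignType.sign ubar : ℝ)) (half_pos hpos) hcov (minSupp u ((2 * L + 1) ^ d))
    hrank hae hlam E hε
  have hcard : ((cubeNhd d L r).card : ℝ) ≤ 2 * (2 * (L : ℝ) + (r + 1 : ℕ)) ^ d := by
    have h := (Nat.le_add_right _ _).trans (card_cubeNhd_add_le d L r)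
    have h' : ((cubeNhd d L r).card : ℝ) ≤ 2 * ((2 * L + 1 + r : ℕ) : ℝ) ^ d := by exact_mod_cast h
    have h2 : ((2 * L + 1 + r : ℕ) : ℝ) = 2 * (L : ℝ) + (r + 1 : ℕ) := by
      push_cast
      ring
    rwa [h2] at h'
  have hle : ε / (lam * (|ubar| / 2)) * (∑ _k ∈ cubeNhd d L r, |(SignType.sign ubar : ℝ)|)
      * (minSupp u ((2 * L + 1) ^ d) : ℝ) * bvNorm ρ
      ≤ 4 / (lam * |ubar|) * (minSupp u ((2 * L + 1) ^ d) : ℝ) * bvNorm ρ * ε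
        * (2 * (L : ℝ) + (r + 1 : ℕ)) ^ d := by
    rw [hsum]
    calc ε / (lam * (|ubar| / 2)) * (cubeNhd d L r).card * (minSupp u ((2 * L + 1) ^ d) : ℝ)
          * bvNorm ρ
        ≤ ε / (lam * (|ubar| / 2)) * (2 * (2 * (L : ℝ) + (r + 1 : ℕ)) ^ d)
          * (minSupp u ((2 * L + 1) ^ d) : ℝ) * bvNorm ρ := by gcongr
      _ = _ := by field_simp; ring
  exact hbound.mono hle

/-- The constant 8 leaves a spare factor 2, which pays for replacing `(2L + 1) ^ d` by `(2L) ^ d`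
when `d ≤ L`. -/
theorem wegnerBound_nonzero_mean {u : (Fin d → ℤ) → ℝ} (hu : Summable u)
    (hu0 : ∑' k, u k ≠ 0) {μ : Measure ℝ} [IsProbabilityMeasure μ] {ρ : ℝ → ℝ}
    (hρ : IsBVDensity μ ρ) (hsupp : HasCompactSupport ρ) {m : ℕ}
    (hm : (∑' k : {k : Fin d → ℤ | (m : ℤ) ≤ l1norm k}, |u k|) ≤ |(∑' k, u k) / 2|)
    {lam : ℝ} (hlam : 0 < lam) {L : ℕ} (hL : 1 ≤ L) (E : ℝ) {ε : ℝ} (hε : 0 < ε) :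
    WegnerBound u lam μ L E ε (8 / (lam * |∑' k, u k|) * (minSupp u ((2 * L + 1) ^ d) : ℝ) *
        bvNorm ρ * ε * (2 * (L : ℝ) + m) ^ d) ∧
      (d ≤ L → WegnerBound u lam μ L E ε (8 / (lam * |∑' k, u k|) *
        (minSupp u ((2 * L) ^ d) : ℝ) * bvNorm ρ * ε * (2 * (L : ℝ) + m) ^ d)) := by
  have hbv : 0 ≤ bvNorm ρ := ENNReal.toReal_nonneg
  have hpos : 0 < |∑' k, u k| := abs_pos.2 hu0
  have h := wegnerBound_of_tsum_ne_zero hu hu0 hρ hsupp hm hlam L E hε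
  refine ⟨h.mono ?_, fun hd => h.mono ?_⟩
  · gcongr
    norm_num
  · have h1 : (minSupp u ((2 * L + 1) ^ d) : ℝ) ≤ 2 * minSupp u ((2 * L) ^ d) := by
      exact_mod_cast minSupp_le_two_mul u (two_mul_add_one_pow_le hL hd)
    calc 4 / (lam * |∑' k, u k|) * (minSupp u ((2 * L + 1) ^ d) : ℝ) * bvNorm ρ * ε
          * (2 * (L : ℝ) + m) ^ d
        ≤ 4 / (lam * |∑' k, u k|) * (2 * minSupp u ((2 * L) ^ d)) * bvNorm ρ * ε
          * (2 * (L : ℝ) + m) ^ d := by gcongr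
      _ = _ := by ring

end NonzeroMean

/-! ### Moments of the single site potential. -/

section Moments

/-- The monomial `k ↦ k^I` on the lattice. -/
def latticeMonomial (I : Fin d → ℕ) (k : Fin d → ℤ) : ℝ := ∏ i, (k i : ℝ) ^ I i

/-- The moment `∑_k k^I u(k)`. -/
def moment (u : (Fin d → ℤ) → ℝ) (I : Fin d → ℕ) : ℝ := ∑' k, latticeMonomial I k * u k

/-- Summation of `u` against a product of one-variable polynomials. -/
theorem hasSum_prod_eval_mul {u : (Fin d → ℤ) → ℝ} (p : Fin d → Polynomial ℝ) (N : Fin d → ℕ)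
    (hN : ∀ i, (p i).natDegree ≤ N i)
    (hs : ∀ J ≤ N, Summable fun k => latticeMonomial J k * u k) :
    HasSum (fun k : Fin d → ℤ => (∏ i, (p i).eval (k i : ℝ)) * u k)
      (∑ J ∈ Fintype.piFinset fun i => Finset.range (N i + 1),
        (∏ i, (p i).coeff (J i)) * moment u J) := by
  have h1 : ∀ k : Fin d → ℤ, (∏ i, (p i).eval (k i : ℝ)) * u k
      = ∑ J ∈ Fintype.piFinset fun i => Finset.range (N i + 1),
        (∏ i, (p i).coeff (J i)) * (latticeMonomial J k * u k) := by
    intro k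
    have h2 : ∀ i, (p i).eval (k i : ℝ)
        = ∑ j ∈ Finset.range (N i + 1), (p i).coeff j * (k i : ℝ) ^ j :=
      fun i => Polynomial.eval_eq_sum_range' (Nat.lt_succ_of_le (hN i)) _
    simp only [h2]
    rw [Finset.prod_univ_sum, Finset.sum_mul]
    refine Finset.sum_congr rfl fun J _ => ?_
    rw [Finset.prod_mul_distrib, latticeMonomial, mul_assoc]
  simp only [h1]
  refine hasSum_sum fun J hJ => ((hs J fun i => ?_).hasSum).mul_left _
  exact Nat.lt_succ_iff.1 (Finset.mem_range.1 (Fintype.mem_piFinset.1 hJ i))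

/-- If all lower moments vanish, the convolution of `u` with a monomial is constant. -/
theorem hasSum_latticeMonomial_mul_sub {u : (Fin d → ℤ) → ℝ} {I : Fin d → ℕ}
    (hs : ∀ J ≤ I, Summable fun k => latticeMonomial J k * u k)
    (h0 : ∀ J < I, moment u J = 0) (x : Fin d → ℤ) :
    HasSum (fun k => latticeMonomial I k * u (x - k)) ((-1) ^ (∑ i, I i) * moment u I) := by
  -- After `k ↦ x - k` the monomial is `∏ (x_i - k_i) ^ I_i`. Its expansion involves moments with `J
  -- ≤ I`, of which only `J = I` survives, with coefficient `(-1) ^ |I|`.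
  rw [← (Equiv.subLeft x).hasSum_iff]
  have h := hasSum_prod_eval_mul (u := u)
    (fun i => (Polynomial.C (x i : ℝ) - Polynomial.X) ^ I i) I (fun i => by
      refine Polynomial.natDegree_pow_le.trans ?_
      have : (Polynomial.C (x i : ℝ) - Polynomial.X).natDegree ≤ 1 := by compute_degree
      nlinarith) hs
  rw [Finset.sum_eq_single I] at h
  · convert h using 1
    · ext k
      simp [latticeMonomial, Equiv.subLeft_apply]
    · congr 1
      rw [← Finset.prod_pow_eq_pow_sum]
      refine Finset.prod_congr rfl fun i _ => ?_
      have h1 := Polynomial.coeff_pow_of_natDegree_le (p := Polynomial.C (x i : ℝ) - Polynomial.X)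
        (n := 1) (by compute_degree) (m := I i)
      rw [mul_one] at h1
      rw [h1, Polynomial.coeff_sub, Polynomial.coeff_C_succ, Polynomial.coeff_X_one, zero_sub]
  · intro J hJ hne
    rw [h0 J (lt_of_le_of_ne (fun i => ?_) hne), mul_zero]
    exact Nat.lt_succ_iff.1 (Finset.mem_range.1 (Fintype.mem_piFinset.1 hJ i))
  · intro h
    exact absurd (Fintype.mem_piFinset.2 fun i => Finset.mem_range.2 (Nat.lt_succ_self _)) h

theorem exists_minimal_moment_ne_zero {u : (Fin d → ℤ) → ℝ} {I : Fin d → ℕ}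
    (hI : moment u I ≠ 0) : ∃ J ≤ I, moment u J ≠ 0 ∧ ∀ K < J, moment u K = 0 := by
  obtain ⟨J, hJI, hJ⟩ := exists_minimal_le_of_wellFoundedLT (fun J => moment u J ≠ 0) I hI
  refine ⟨J, hJI, hJ.prop, fun K hK => ?_⟩
  by_contra h
  exact hJ.not_lt h hK

/-- A product of Lagrange basis polynomials on `{0, …, n}` is the indicator of a point `k₀` on the
box. Summing `u` against it gives `u k₀`, a combination of moments with exponents at most `n`. -/
theorem exists_moment_ne_zero_of_support {u : (Fin d → ℤ) → ℝ} (hu : u ≠ 0) {n : ℕ}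
    (hn : ∀ k, u k ≠ 0 → ∀ i, 0 ≤ k i ∧ k i ≤ (n : ℤ)) :
    ∃ I : Fin d → ℕ, (∀ i, I i ≤ n) ∧ moment u I ≠ 0 := by
  by_contra! h
  obtain ⟨k₀, hk₀⟩ := Function.ne_iff.1 hu
  have hinj : Set.InjOn (fun j : ℤ => (j : ℝ)) (Finset.Icc 0 (n : ℤ)) :=
    Int.cast_injective.injOn
  have hmem : ∀ k, u k ≠ 0 → ∀ i, k i ∈ Finset.Icc 0 (n : ℤ) :=
    fun k hk i => Finset.mem_Icc.2 (hn k hk i)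
  have hfin : (Function.support u).Finite :=
    (Finset.finite_toSet (Finset.Icc (fun _ => 0) (fun _ => (n : ℤ)))).subset fun k hk =>
      Finset.mem_coe.2 (Finset.mem_Icc.2 ⟨fun i => (hn k hk i).1, fun i => (hn k hk i).2⟩)
  have hsum := hasSum_prod_eval_mul (u := u)
    (fun i => Lagrange.basis (Finset.Icc 0 (n : ℤ)) (fun j => (j : ℝ)) (k₀ i)) (fun _ => n)
    (fun i => by
      rw [Polynomial.natDegree_le_iff_degree_le, Lagrange.degree_basis hinj (hmem k₀ hk₀ i)]
      simp) (fun J _ => summable_of_hasFiniteSupport (hfin.subset fun k hk => right_ne_zero_of_mul hk))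
  rw [Finset.sum_eq_zero] at hsum
  · have h1 := hsum.unique (hasSum_single k₀ fun k hk => ?_)
    · rw [Finset.prod_eq_one, one_mul] at h1
      · exact hk₀ h1.symm
      · intro i _
        exact Lagrange.eval_basis_self hinj (hmem k₀ hk₀ i)
    · by_cases hk0 : u k = 0
      · rw [hk0, mul_zero]
      · obtain ⟨i, hi⟩ := Function.ne_iff.1 hk
        rw [Finset.prod_eq_zero (Finset.mem_univ i), zero_mul]
        exact Lagrange.eval_basis_of_ne hi.symm (hmem k hk0 i)
  · intro J hJ
    rw [h J fun i => Nat.lt_succ_iff.1 (Finset.mem_range.1 (Fintype.mem_piFinset.1 hJ i)), mul_zero]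

theorem abs_latticeMonomial_le {I : Fin d → ℕ} {k : Fin d → ℤ} {R : ℝ}
    (h : ∀ i, |(k i : ℝ)| ≤ R) : |latticeMonomial I k| ≤ R ^ ∑ i, I i := by
  rw [latticeMonomial, Finset.abs_prod, ← Finset.prod_pow_eq_pow_sum]
  refine Finset.prod_le_prod (fun i _ => abs_nonneg _) fun i _ => ?_
  rw [abs_pow]
  exact pow_le_pow_left₀ (abs_nonneg _) (h i) _

end Moments

/-! ### Finitely supported potentials. -/

section FiniteSupport

theorem wegnerBound_finite_support {u : (Fin d → ℤ) → ℝ} {I : Fin d → ℕ} (hI : moment u I ≠ 0)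
    (hlow : ∀ J < I, moment u J = 0) {n : ℕ}
    (hn : ∀ k, u k ≠ 0 → ∀ i, 0 ≤ k i ∧ k i ≤ (n : ℤ)) (hIn : ∀ i, I i ≤ n)
    {μ : Measure ℝ} [IsProbabilityMeasure μ] {ρ : ℝ → ℝ} (hρ : IsBVDensity μ ρ)
    {lam : ℝ} (hlam : 0 < lam) {L : ℕ} (hL : 1 ≤ L) (E : ℝ) {ε : ℝ} (hε : 0 < ε) :
    WegnerBound u lam μ L E ε (2 ^ d / |moment u I| / lam * ((Function.support u).ncard : ℝ) *
      bvNorm ρ * ε * (2 * (L : ℝ) + n) ^ (d * (n + 1))) := by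
  have hfin : (Function.support u).Finite :=
    (Finset.finite_toSet (Finset.Icc (fun _ => 0) (fun _ => (n : ℤ)))).subset fun k hk =>
      Finset.mem_coe.2 (Finset.mem_Icc.2 ⟨fun i => (hn k hk i).1, fun i => (hn k hk i).2⟩)
  have hbv : 0 ≤ bvNorm ρ := ENNReal.toReal_nonneg
  have hL' : (1 : ℝ) ≤ L := by exact_mod_cast hL
  set c := (-1 : ℝ) ^ (∑ i, I i) * moment u I with hc
  have hcabs : |c| = |moment u I| := by
    rw [hc, abs_mul, abs_pow, abs_neg, abs_one, one_pow, one_mul]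
  have hpos : 0 < |c| := by rw [hcabs]; exact abs_pos.2 hI
  have hc0 : c ≠ 0 := abs_pos.1 hpos
  -- All `k` for which `x - k` can lie in `[0, n]^d` with `x` in the cube, so the sum over `S` is
  -- the full convolution.
  set S : Finset (Fin d → ℤ) := Finset.Icc (fun _ => -(L : ℤ) - n) (fun _ => (L : ℤ)) with hS
  have hcov : ∀ x ∈ cube d L,
      |c| ≤ ∑ k ∈ S, (SignType.sign c : ℝ) * latticeMonomial I k * u (x - k) := by
    intro x hx
    rw [mem_cube] at hx
    have h1 := hasSum_latticeMonomial_mul_sub (u := u) (I := I)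
      (fun J _ => summable_of_hasFiniteSupport (hfin.subset fun k hk => right_ne_zero_of_mul hk))
      hlow x
    have h2 : ∑ k ∈ S, latticeMonomial I k * u (x - k) = c := by
      refine (hasSum_sum_of_ne_finset_zero fun k hk => ?_).unique h1
      by_contra h
      have h3 := hn _ (right_ne_zero_of_mul h)
      refine hk (Finset.mem_Icc.2 ⟨fun i => ?_, fun i => ?_⟩)
      all_goals
        have h4 := h3 i
        have h5 := hx i
        rw [Pi.sub_apply] at h4
        dsimp only
        omega
    simp only [mul_assoc]
    rw [← Finset.mul_sum, h2, sign_mul_self]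
  have hsum : ∑ k ∈ S, |(SignType.sign c : ℝ) * latticeMonomial I k|
      ≤ 2 ^ d * (2 * (L : ℝ) + n) ^ (d * (n + 1)) := by
    have hsign : |(SignType.sign c : ℝ)| = 1 := by
      rcases lt_or_gt_of_ne hc0 with h | h
      · simp [sign_neg h]
      · simp [sign_pos h]
    have hR : (1 : ℝ) ≤ 2 * L + n := by
      have : (0 : ℝ) ≤ n := by positivity
      linarith
    have hexp : ∑ i, I i ≤ d * n := by
      simpa using Finset.sum_le_card_nsmul Finset.univ I n fun i _ => hIn i
    -- The side of `S` has `2L + n + 1` points; the factor `2 ^ d` of the constant absorbs the `+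
    -- 1`.
    have hcard : (S.card : ℝ) ≤ (2 * (2 * (L : ℝ) + n)) ^ d := by
      rw [hS, Pi.card_Icc]
      simp only [Int.card_Icc, Finset.prod_const, Finset.card_univ, Fintype.card_fin]
      have : ((L : ℤ) + 1 - (-(L : ℤ) - n)).toNat = 2 * L + n + 1 := by omega
      rw [this]
      push_cast
      refine pow_le_pow_left₀ (by positivity) ?_ _
      linarith
    calc ∑ k ∈ S, |(SignType.sign c : ℝ) * latticeMonomial I k|
        ≤ ∑ _k ∈ S, (2 * (L : ℝ) + n) ^ (d * n) := by
          refine Finset.sum_le_sum fun k hk => ?_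
          rw [abs_mul, hsign, one_mul]
          refine (abs_latticeMonomial_le fun i => ?_).trans (pow_le_pow_right₀ hR hexp)
          rw [Finset.mem_Icc] at hk
          have h1 := hk.1 i
          have h2 := hk.2 i
          dsimp only at h1 h2
          have h3 : |k i| ≤ 2 * (L : ℤ) + n := by rw [abs_le]; omega
          exact_mod_cast h3
      _ = S.card * (2 * (L : ℝ) + n) ^ (d * n) := by rw [Finset.sum_const, nsmul_eq_mul]
      _ ≤ (2 * (2 * (L : ℝ) + n)) ^ d * (2 * (L : ℝ) + n) ^ (d * n) := by gcongr
      _ = _ := by rw [mul_pow]; ring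
  have hbound := wegnerBound_of_covering hρ S
    (fun k => (SignType.sign c : ℝ) * latticeMonomial I k) hpos hcov (Function.support u).ncard
    (fun k _ => by
      have := card_filter_le_encard_support u L k
      rw [← hfin.cast_ncard_eq] at this
      exact_mod_cast this)
    (Filter.Eventually.of_forall fun ω x => summable_coupling_of_finite_support hfin ω x)
    hlam E hε
  refine hbound.mono ?_
  calc ε / (lam * |c|) * (∑ k ∈ S, |(SignType.sign c : ℝ) * latticeMonomial I k|)
        * ((Function.support u).ncard : ℝ) * bvNorm ρ
      ≤ ε / (lam * |c|) * (2 ^ d * (2 * (L : ℝ) + n) ^ (d * (n + 1)))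
        * ((Function.support u).ncard : ℝ) * bvNorm ρ := by gcongr
    _ = _ := by rw [hcabs]; field_simp

theorem exists_wegner_constant_of_support {u : (Fin d → ℤ) → ℝ} (hu0 : u ≠ 0) :
    ∃ c : ℝ, 0 < c ∧
      ∀ n : ℕ, (∀ k, u k ≠ 0 → ∀ i, 0 ≤ k i ∧ k i ≤ (n : ℤ)) →
      ∀ (μ : Measure ℝ) [IsProbabilityMeasure μ] (ρ : ℝ → ℝ), IsBVDensity μ ρ →
      ∀ lam : ℝ, 0 < lam → ∀ L : ℕ, 1 ≤ L → ∀ E ε : ℝ, 0 < ε →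
        WegnerBound u lam μ L E ε
          (c / lam * ((Function.support u).ncard : ℝ) * bvNorm ρ * ε *
            (2 * (L : ℝ) + n) ^ (d * (n + 1))) := by
  classical
  -- The constant may not depend on `n`, so the moment is taken for the least admissible `n`; its
  -- exponents are then bounded by every admissible `n`.
  by_cases hex : ∃ n : ℕ, ∀ k, u k ≠ 0 → ∀ i, 0 ≤ k i ∧ k i ≤ (n : ℤ)
  · obtain ⟨I, hIn, hI⟩ := exists_moment_ne_zero_of_support hu0 (Nat.find_spec hex)
    obtain ⟨J, hJI, hJ, hlow⟩ := exists_minimal_moment_ne_zero hI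
    refine ⟨2 ^ d / |moment u J|, div_pos (by positivity) (abs_pos.2 hJ), ?_⟩
    intro n hn μ _ ρ hρ lam hlam L hL E ε hε
    exact wegnerBound_finite_support hJ hlow hn
      (fun i => (hJI i).trans ((hIn i).trans (Nat.find_min' hex hn))) hρ hlam hL E hε
  · exact ⟨1, one_pos, fun n hn => absurd ⟨n, hn⟩ hex⟩

end FiniteSupport

/-! ### Exponentially decaying potentials and the moment problem. -/

section ExponentialDecay

theorem summable_prod_apply {α : Type*} {f : α → ℝ} (hf : Summable f) (hf0 : ∀ j, 0 ≤ f j) (d : ℕ) :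
    Summable fun k : Fin d → α => ∏ i, f (k i) := by
  induction d with
  | zero => exact summable_of_hasFiniteSupport (Set.toFinite _)
  | succ d ih =>
    rw [← (Fin.consEquiv fun _ : Fin (d + 1) => α).summable_iff]
    refine (hf.mul_of_nonneg ih hf0 fun k => Finset.prod_nonneg fun i _ => hf0 _).congr
      fun p => ?_
    simp [Fin.consEquiv, Fin.prod_univ_succ]

theorem l1norm_nonneg (k : Fin d → ℤ) : 0 ≤ l1norm k :=
  Finset.sum_nonneg fun _ _ => abs_nonneg _

theorem l1norm_cast (k : Fin d → ℤ) : (l1norm k : ℝ) = ∑ i, |(k i : ℝ)| := by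
  simp [l1norm]

theorem abs_apply_le_l1norm (k : Fin d → ℤ) (i : Fin d) : |(k i : ℝ)| ≤ l1norm k := by
  rw [l1norm_cast]
  exact Finset.single_le_sum (f := fun i => |(k i : ℝ)|) (fun _ _ => abs_nonneg _)
    (Finset.mem_univ i)

theorem summable_exp_neg_l1norm (d : ℕ) {β : ℝ} (hβ : 0 < β) :
    Summable fun k : Fin d → ℤ => Real.exp (-β * (l1norm k : ℝ)) := by
  have h1 : Summable fun n : ℕ => Real.exp (n * (-β)) :=
    Real.summable_exp_nat_mul_iff.2 (by linarith)
  have h2 : Summable fun j : ℤ => Real.exp (-β * |(j : ℝ)|) := by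
    refine Summable.of_nat_of_neg (h1.congr fun n => ?_) (h1.congr fun n => ?_)
    · rw [Int.cast_natCast, Nat.abs_cast, mul_comm]
    · rw [Int.cast_neg, Int.cast_natCast, abs_neg, Nat.abs_cast, mul_comm]
  refine (summable_prod_apply h2 (fun _ => (Real.exp_pos _).le) d).congr fun k => ?_
  rw [← Real.exp_sum, ← Finset.mul_sum, l1norm_cast]

theorem summable_exp_l1norm_mul {u : (Fin d → ℤ) → ℝ} {C α : ℝ}
    (hu : ∀ k, |u k| ≤ C * Real.exp (-α * (l1norm k : ℝ))) {t : ℝ} (ht : t < α) :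
    Summable fun k => Real.exp (t * (l1norm k : ℝ)) * |u k| := by
  refine Summable.of_nonneg_of_le (fun k => by positivity) (fun k => ?_)
    ((summable_exp_neg_l1norm d (sub_pos.2 ht)).mul_left C)
  calc Real.exp (t * (l1norm k : ℝ)) * |u k|
      ≤ Real.exp (t * (l1norm k : ℝ)) * (C * Real.exp (-α * (l1norm k : ℝ))) := by
        gcongr
        exact hu k
    _ = C * Real.exp (-(α - t) * (l1norm k : ℝ)) := by
        rw [mul_left_comm, ← Real.exp_add]
        congr 2
        ring

theorem summable_l1norm_pow_mul {u : (Fin d → ℤ) → ℝ} {C α : ℝ} (hα : 0 < α)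
    (hu : ∀ k, |u k| ≤ C * Real.exp (-α * (l1norm k : ℝ))) (p : ℕ) :
    Summable fun k => (l1norm k : ℝ) ^ p * |u k| := by
  have hs : 0 < α / 2 := half_pos hα
  refine Summable.of_nonneg_of_le (fun k => ?_) (fun k => ?_)
    ((summable_exp_l1norm_mul hu (half_lt_self hα)).mul_left (p.factorial / (α / 2) ^ p))
  · have : (0 : ℝ) ≤ l1norm k := by exact_mod_cast l1norm_nonneg k
    positivity
  · have h0 : (0 : ℝ) ≤ l1norm k := by exact_mod_cast l1norm_nonneg k
    have h1 := Real.pow_div_factorial_le_exp (α / 2 * l1norm k) (by positivity) p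
    rw [← mul_assoc]
    refine mul_le_mul_of_nonneg_right ?_ (abs_nonneg _)
    rw [div_le_iff₀ (by positivity), mul_pow] at h1
    rw [div_mul_eq_mul_div, le_div_iff₀ (by positivity)]
    linarith

theorem abs_latticeMonomial_le_l1norm (I : Fin d → ℕ) (k : Fin d → ℤ) :
    |latticeMonomial I k| ≤ (l1norm k : ℝ) ^ ∑ i, I i :=
  abs_latticeMonomial_le fun i => abs_apply_le_l1norm k i

theorem summable_latticeMonomial_mul {u : (Fin d → ℤ) → ℝ} {C α : ℝ} (hα : 0 < α)
    (hu : ∀ k, |u k| ≤ C * Real.exp (-α * (l1norm k : ℝ))) (I : Fin d → ℕ) :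
    Summable fun k => latticeMonomial I k * u k := by
  refine Summable.of_norm_bounded (summable_l1norm_pow_mul hα hu (∑ i, I i)) fun k => ?_
  rw [Real.norm_eq_abs, abs_mul]
  exact mul_le_mul_of_nonneg_right (abs_latticeMonomial_le_l1norm I k) (abs_nonneg _)

open ProbabilityTheory in
/-- Finite measures with exponential moments are determined by their moments. -/
theorem map_eq_of_moments_eq {Ω : Type*} [MeasurableSpace Ω] {ν₁ ν₂ : Measure Ω}
    [IsFiniteMeasure ν₁] [IsFiniteMeasure ν₂] {X : Ω → ℝ} (hX : Measurable X) {c : ℝ} (hc : 0 < c)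
    (h1 : ∀ t, |t| < c → Integrable (fun ω => Real.exp (t * X ω)) ν₁)
    (h2 : ∀ t, |t| < c → Integrable (fun ω => Real.exp (t * X ω)) ν₂)
    (hmom : ∀ n : ℕ, ∫ ω, X ω ^ n ∂ν₁ = ∫ ω, X ω ^ n ∂ν₂) : ν₁.map X = ν₂.map X := by
  -- The complex moment generating functions are analytic on this strip. Equal moments give equal
  -- Taylor series at 0, the identity theorem gives equality on the strip, and the imaginary axis
  -- carries the characteristic functions.
  set U : Set ℂ := {z | z.re ∈ Set.Ioo (-c) c} with hU
  have hint : ∀ ν : Measure Ω, (∀ t, |t| < c → Integrable (fun ω => Real.exp (t * X ω)) ν) →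
      Set.Ioo (-c) c ⊆ interior (integrableExpSet X ν) := fun ν h =>
    interior_maximal (fun t ht => h t (abs_lt.2 ht)) isOpen_Ioo
  have han : ∀ ν : Measure Ω, (∀ t, |t| < c → Integrable (fun ω => Real.exp (t * X ω)) ν) →
      AnalyticOnNhd ℂ (complexMGF X ν) U := fun ν h =>
    analyticOnNhd_complexMGF.mono fun z hz => hint ν h hz
  have h0 : (0 : ℂ) ∈ U := by simp [hU, hc]
  have hder : ∀ ν : Measure Ω, (∀ t, |t| < c → Integrable (fun ω => Real.exp (t * X ω)) ν) →
      ∀ n : ℕ, iteratedDeriv n (complexMGF X ν) 0 = ((∫ ω, X ω ^ n ∂ν : ℝ) : ℂ) := by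
    intro ν h n
    rw [iteratedDeriv_complexMGF (hint ν h h0), ← integral_complex_ofReal]
    simp
  have heq : complexMGF X ν₁ =ᶠ[nhds 0] complexMGF X ν₂ := by
    have hp1 := (han ν₁ h1 0 h0).hasFPowerSeriesAt
    have hp2 := (han ν₂ h2 0 h0).hasFPowerSeriesAt
    simp only [hder ν₁ h1, hmom] at hp1
    simp only [hder ν₂ h2] at hp2
    have h3 := hp1.sub hp2
    rw [sub_self] at h3
    filter_upwards [h3.eventually_eq_zero] with z hz
    exact sub_eq_zero.1 hz
  have hconn : IsPreconnected U :=
    ((convex_Ioo (-c) c).linear_preimage Complex.reLm).isPreconnected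
  have hEq := (han ν₁ h1).eqOn_of_preconnected_of_eventuallyEq (han ν₂ h2) hconn h0 heq
  refine Measure.ext_of_charFun (funext fun t => ?_)
  rw [← complexMGF_mul_I hX.aemeasurable, ← complexMGF_mul_I hX.aemeasurable]
  exact hEq (by simp [hU, hc])

/-- There is an injective linear functional on the lattice with real values. -/
theorem exists_injective_linear (d : ℕ) :
    ∃ ξ : Fin d → ℝ, Function.Injective fun k : Fin d → ℤ => ∑ i, (k i : ℝ) * ξ i := by
  -- With `ξ_i = τ ^ i` and `τ` transcendental, two lattice points of equal image would give a
  -- nonzero integer polynomial vanishing at `τ`.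
  have htr := transcendental_liouvilleNumber (m := 2) le_rfl
  set τ := liouvilleNumber ((2 : ℕ) : ℝ)
  refine ⟨fun i => τ ^ (i : ℕ), fun k k' h => ?_⟩
  set p : Polynomial ℤ := ∑ i : Fin d, Polynomial.monomial (i : ℕ) (k i - k' i) with hp
  have hp0 : p = 0 := by
    by_contra hne
    refine htr ⟨p, hne, ?_⟩
    rw [hp, map_sum]
    simp only [Polynomial.aeval_monomial, map_sub, Finset.sum_sub_distrib]
    exact sub_eq_zero.2 h
  ext i
  have h1 : p.coeff i = k i - k' i := by
    rw [hp, Polynomial.finsetSum_coeff]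
    simp [Polynomial.coeff_monomial, Fin.val_inj]
  rw [hp0, Polynomial.coeff_zero] at h1
  linarith

/-- The measure on the lattice with density `w` with respect to the counting measure. -/
def weightMeasure (w : (Fin d → ℤ) → ℝ) : Measure (Fin d → ℤ) :=
  Measure.count.withDensity fun k => ENNReal.ofReal (w k)

theorem weightMeasure_singleton (w : (Fin d → ℤ) → ℝ) (k : Fin d → ℤ) :
    weightMeasure w {k} = ENNReal.ofReal (w k) := by
  rw [weightMeasure, withDensity_apply _ (measurableSet_singleton k), Measure.restrict_singleton,
    lintegral_smul_measure, lintegral_dirac]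
  simp

theorem integrable_weightMeasure {w : (Fin d → ℤ) → ℝ} (hw : ∀ k, 0 ≤ w k)
    {f : (Fin d → ℤ) → ℝ} (hf : Summable fun k => f k * w k) : Integrable f (weightMeasure w) := by
  refine ⟨(measurable_of_countable f).aestronglyMeasurable, ?_⟩
  rw [hasFiniteIntegral_iff_enorm, lintegral_countable']
  have h1 : ∀ k, ‖f k‖ₑ * weightMeasure w {k} = ENNReal.ofReal |f k * w k| := by
    intro k
    rw [weightMeasure_singleton, Real.enorm_eq_ofReal_abs, ← ENNReal.ofReal_mul (abs_nonneg _),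
      abs_mul, abs_of_nonneg (hw k)]
  simp only [h1]
  exact hf.abs.tsum_ofReal_lt_top

theorem integral_weightMeasure {w : (Fin d → ℤ) → ℝ} (hw : ∀ k, 0 ≤ w k)
    {f : (Fin d → ℤ) → ℝ} (hf : Summable fun k => f k * w k) :
    ∫ k, f k ∂weightMeasure w = ∑' k, f k * w k := by
  rw [integral_countable (integrable_weightMeasure hw hf)]
  refine tsum_congr fun k => ?_
  rw [Measure.real, weightMeasure_singleton, ENNReal.toReal_ofReal (hw k), smul_eq_mul, mul_comm]

theorem isFiniteMeasure_weightMeasure {w : (Fin d → ℤ) → ℝ} (hw : ∀ k, 0 ≤ w k)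
    (hs : Summable w) : IsFiniteMeasure (weightMeasure w) := by
  refine ⟨?_⟩
  have h := integrable_weightMeasure (f := fun _ => (1 : ℝ)) hw (by simpa using hs)
  rw [integrable_const_iff_isFiniteMeasure one_ne_zero] at h
  exact measure_lt_top _ _

/-- An exponentially decaying function on the lattice is determined by its moments. -/
theorem exists_moment_ne_zero_of_exp_decay {u : (Fin d → ℤ) → ℝ} (hu0 : u ≠ 0) {C α : ℝ}
    (hα : 0 < α) (hu : ∀ k, |u k| ≤ C * Real.exp (-α * (l1norm k : ℝ))) :
    ∃ I, moment u I ≠ 0 := by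
  by_contra! hmom
  obtain ⟨ξ, hξ⟩ := exists_injective_linear d
  set X : (Fin d → ℤ) → ℝ := fun k => ∑ i, (k i : ℝ) * ξ i with hXdef
  set B := ∑ i, |ξ i| + 1 with hB
  have hB0 : 0 < B := by
    have : 0 ≤ ∑ i, |ξ i| := Finset.sum_nonneg fun _ _ => abs_nonneg _
    linarith
  have hXle : ∀ k, |X k| ≤ B * l1norm k := by
    intro k
    have h0 : (0 : ℝ) ≤ l1norm k := by exact_mod_cast l1norm_nonneg k
    calc |X k| ≤ ∑ i, |(k i : ℝ) * ξ i| := Finset.abs_sum_le_sum_abs _ _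
      _ ≤ ∑ i, (l1norm k : ℝ) * |ξ i| := by
          refine Finset.sum_le_sum fun i _ => ?_
          rw [abs_mul]
          exact mul_le_mul_of_nonneg_right (abs_apply_le_l1norm k i) (abs_nonneg _)
      _ ≤ B * l1norm k := by
          rw [← Finset.mul_sum, hB]
          nlinarith
  have hexp : ∀ t, |t| < α / B → Summable fun k => Real.exp (t * X k) * |u k| := by
    intro t ht
    rw [lt_div_iff₀ hB0] at ht
    refine Summable.of_nonneg_of_le (fun k => by positivity) (fun k => ?_)
      (summable_exp_l1norm_mul hu ht)
    refine mul_le_mul_of_nonneg_right (Real.exp_le_exp.2 ?_) (abs_nonneg _)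
    calc t * X k ≤ |t| * |X k| := by rw [← abs_mul]; exact le_abs_self _
      _ ≤ |t| * (B * l1norm k) := mul_le_mul_of_nonneg_left (hXle k) (abs_nonneg _)
      _ = |t| * B * l1norm k := by ring
  -- By the multinomial formula the moments of `u` along the linear functional `X` are combinations
  -- of the lattice moments. This reduces the problem to one dimension.
  have hpow : ∀ n : ℕ, HasSum (fun k => X k ^ n * u k) 0 := by
    intro n
    have h1 : ∀ k, X k ^ n * u k = ∑ J ∈ Finset.univ.piAntidiag n,
        ((Nat.multinomial Finset.univ J : ℝ) * ∏ i, ξ i ^ J i) * (latticeMonomial J k * u k) := by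
      intro k
      simp only [hXdef]
      rw [Finset.sum_pow_eq_sum_piAntidiag, Finset.sum_mul]
      refine Finset.sum_congr rfl fun J _ => ?_
      simp only [mul_pow, Finset.prod_mul_distrib, latticeMonomial]
      ring
    have h2 : (0 : ℝ) = ∑ J ∈ Finset.univ.piAntidiag n,
        ((Nat.multinomial Finset.univ J : ℝ) * ∏ i, ξ i ^ J i) * moment u J := by
      rw [Finset.sum_eq_zero]
      intro J _
      rw [hmom J, mul_zero]
    simp only [h1]
    rw [h2]
    exact hasSum_sum fun J _ => ((summable_latticeMonomial_mul hα hu J).hasSum).mul_left _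
  have hpos : ∀ k, 0 ≤ max (u k) 0 := fun k => le_max_right _ _
  have hneg : ∀ k, 0 ≤ max (-u k) 0 := fun k => le_max_right _ _
  have hdom : ∀ (f w : (Fin d → ℤ) → ℝ), (∀ k, |w k| ≤ |u k|) →
      (Summable fun k => f k * u k) → Summable fun k => f k * w k := by
    intro f w hw hf
    refine Summable.of_norm_bounded hf.abs fun k => ?_
    rw [Real.norm_eq_abs, abs_mul, abs_mul]
    exact mul_le_mul_of_nonneg_left (hw k) (abs_nonneg _)
  have hwp : ∀ k, |max (u k) 0| ≤ |u k| := fun k => by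
    rw [abs_of_nonneg (hpos k)]
    exact max_le (le_abs_self _) (abs_nonneg _)
  have hwn : ∀ k, |max (-u k) 0| ≤ |u k| := fun k => by
    rw [abs_of_nonneg (hneg k)]
    exact max_le (neg_le_abs _) (abs_nonneg _)
  have hexp' : ∀ t, |t| < α / B → Summable fun k => Real.exp (t * X k) * u k := fun t ht =>
    (hexp t ht).of_norm_bounded fun k => by
      rw [Real.norm_eq_abs, abs_mul, abs_of_pos (Real.exp_pos _)]
  have hone : Summable fun k => (1 : ℝ) * u k := by
    simpa using hexp' 0 (by rw [abs_zero]; positivity)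
  have := isFiniteMeasure_weightMeasure hpos (by simpa using hdom (fun _ => 1) _ hwp hone)
  have := isFiniteMeasure_weightMeasure hneg (by simpa using hdom (fun _ => 1) _ hwn hone)
  have hmap := map_eq_of_moments_eq (ν₁ := weightMeasure fun k => max (u k) 0)
    (ν₂ := weightMeasure fun k => max (-u k) 0) (X := X) (measurable_of_countable X)
    (div_pos hα hB0)
    (fun t ht => integrable_weightMeasure hpos (hdom _ _ hwp (hexp' t ht)))
    (fun t ht => integrable_weightMeasure hneg (hdom _ _ hwn (hexp' t ht)))
    (fun n => by
      have hp := hdom _ _ hwp (hpow n).summable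
      have hn := hdom _ _ hwn (hpow n).summable
      rw [integral_weightMeasure hpos hp, integral_weightMeasure hneg hn, ← sub_eq_zero,
        ← hp.tsum_sub hn]
      refine (tsum_congr fun k => ?_).trans (hpow n).tsum_eq
      rw [← mul_sub, max_zero_sub_max_neg_zero_eq_self])
  -- Since `X` is injective, equality of the image measures at `X k` compares the positive and
  -- negative parts of `u` at the single site `k`.
  refine hu0 (funext fun k => ?_)
  have h1 := congrArg (fun ν : Measure ℝ => ν {X k}) hmap
  have h2 : X ⁻¹' {X k} = {k} := by
    ext j
    simp only [Set.mem_preimage, Set.mem_singleton_iff]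
    exact hξ.eq_iff
  simp only [Measure.map_apply (measurable_of_countable X) (measurableSet_singleton _), h2,
    weightMeasure_singleton] at h1
  rw [ENNReal.ofReal_eq_ofReal_iff (hpos k) (hneg k)] at h1
  rw [← max_zero_sub_max_neg_zero_eq_self (u k), h1, sub_self, Pi.zero_apply]

/-- Truncating the convolution with `k^I` to the cube of radius `(1 + s) L` leaves an error of at
most `2 ^ |I| / s` times the absolute moment of order `|I| + 1`. The condition on `s` makes this at
most half of the limit, uniformly in `L`. -/
theorem wegnerBound_exp_decay {u : (Fin d → ℤ) → ℝ} (husum : Summable u) {C α : ℝ} (hα : 0 < α)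
    (hu : ∀ k, |u k| ≤ C * Real.exp (-α * (l1norm k : ℝ))) {I : Fin d → ℕ} (hI : moment u I ≠ 0)
    (hlow : ∀ J < I, moment u J = 0) {s : ℕ} (hs1 : 1 ≤ s)
    (hs : 2 ^ (∑ i, I i) * (∑' k, (l1norm k : ℝ) ^ (∑ i, I i + 1) * |u k|)
      ≤ s * (|moment u I| / 2))
    {μ : Measure ℝ} [IsProbabilityMeasure μ] {ρ : ℝ → ℝ} (hρ : IsBVDensity μ ρ)
    (hb : Bornology.IsBounded (Function.support ρ))
    {lam : ℝ} (hlam : 0 < lam) {L : ℕ} (hL : 1 ≤ L) (E : ℝ) {ε : ℝ} (hε : 0 < ε) :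
    WegnerBound u lam μ L E ε (2 * (1 + s : ℝ) ^ (d + ∑ i, I i) / |moment u I| / lam *
      bvNorm ρ * ε * (2 * (L : ℝ) + 1) ^ (2 * d + ∑ i, I i)) := by
  have hbv : 0 ≤ bvNorm ρ := ENNReal.toReal_nonneg
  have hs0 : (0 : ℝ) < s := by exact_mod_cast hs1
  set p := ∑ i, I i with hp
  set c := (-1 : ℝ) ^ p * moment u I with hc
  have hcabs : |c| = |moment u I| := by
    rw [hc, abs_mul, abs_pow, abs_neg, abs_one, one_pow, one_mul]
  have hpos : 0 < |c| := by rw [hcabs]; exact abs_pos.2 hI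
  have hc0 : c ≠ 0 := abs_pos.1 hpos
  rw [← hcabs] at hs
  have hcov : ∀ x ∈ cube d L, |c| / 2
      ≤ ∑ k ∈ cube d ((1 + s) * L), (SignType.sign c : ℝ) * latticeMonomial I k * u (x - k) := by
    intro x hx
    rw [mem_cube] at hx
    have h1 := hasSum_latticeMonomial_mul_sub (u := u) (I := I)
      (fun J _ => summable_latticeMonomial_mul hα hu J) hlow x
    rw [← hp, ← hc] at h1
    obtain ⟨g, hg⟩ : ∃ g : (Fin d → ℤ) → ℝ,
        ∀ k, g k = 2 ^ p / s * ((l1norm k : ℝ) ^ (p + 1) * |u k|) := ⟨_, fun _ => rfl⟩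
    have hgs : Summable g := by
      simp only [funext hg]
      exact (summable_l1norm_pow_mul hα hu (p + 1)).mul_left _
    have hgsum : ∑' k, g (x - k) ≤ |c| / 2 := by
      have h2 : ∑' k, g (x - k) = ∑' k, g k := (Equiv.subLeft x).tsum_eq g
      rw [h2]
      simp only [funext hg]
      rw [tsum_mul_left, div_mul_eq_mul_div, div_le_iff₀ hs0]
      linarith
    have hg' : Summable fun k => g (x - k) :=
      (Equiv.summable_iff (f := g) (Equiv.subLeft x)).2 hgs
    have hg0 : ∀ k, 0 ≤ g k := by
      intro k
      have : (0 : ℝ) ≤ l1norm k := by exact_mod_cast l1norm_nonneg k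
      rw [hg]
      positivity
    have hgk : ∀ k ∉ cube d ((1 + s) * L), |latticeMonomial I k * u (x - k)| ≤ g (x - k) := by
      intro k hk
      rw [mem_cube, not_forall] at hk
      obtain ⟨i, hi⟩ := hk
      have h3 : ∀ i, |(((x - k) i : ℤ) : ℝ)| ≤ l1norm (x - k) := abs_apply_le_l1norm (x - k)
      have h3' : ∀ i, |x i - k i| ≤ l1norm (x - k) := fun i => by exact_mod_cast h3 i
      -- Distance at least `s` gains the factor `1 / s` at the price of one more power of the norm.
      -- Distance at least `L` bounds the coordinates of `k` by twice the distance.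
      have h4 : (s * L : ℕ) ≤ l1norm (x - k) := by
        refine le_trans ?_ (h3' i)
        have := hx i
        rw [add_mul, one_mul] at hi
        generalize s * L = q at *
        rw [le_abs]
        omega
      have h5 : (s : ℤ) ≤ l1norm (x - k) :=
        le_trans (by exact_mod_cast Nat.le_mul_of_pos_right s hL) h4
      have h6 : (L : ℤ) ≤ l1norm (x - k) :=
        le_trans (by exact_mod_cast Nat.le_mul_of_pos_left L hs1) h4
      have h7 : ∀ i, |(k i : ℝ)| ≤ 2 * l1norm (x - k) := by
        intro i
        have := hx i
        have h8 := h3' i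
        have : |k i| ≤ 2 * l1norm (x - k) := by
          rw [abs_le] at h8 ⊢
          omega
        exact_mod_cast this
      have h9 : (s : ℝ) ≤ l1norm (x - k) := by exact_mod_cast h5
      rw [abs_mul, hg]
      calc |latticeMonomial I k| * |u (x - k)|
          ≤ (2 * (l1norm (x - k) : ℝ)) ^ p * |u (x - k)| :=
            mul_le_mul_of_nonneg_right (abs_latticeMonomial_le h7) (abs_nonneg _)
        _ = 2 ^ p / s * (((l1norm (x - k) : ℝ) ^ p * s) * |u (x - k)|) := by
            rw [mul_pow]
            field_simp
        _ ≤ 2 ^ p / s * (((l1norm (x - k) : ℝ) ^ p * l1norm (x - k)) * |u (x - k)|) := by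
            have : (0 : ℝ) ≤ l1norm (x - k) := hs0.le.trans h9
            gcongr
        _ = _ := by rw [pow_succ]
    have h2 := (abs_sum_sub_tsum_le h1.summable (cube d ((1 + s) * L)) hg'
      (fun k _ => hg0 (x - k)) hgk).trans hgsum
    rw [h1.tsum_eq] at h2
    have h4 := abs_le.1 h2
    simp only [mul_assoc]
    rw [← Finset.mul_sum]
    rcases lt_or_gt_of_ne hc0 with hneg | hneg
    · rw [sign_neg hneg]
      rw [abs_of_neg hneg] at h4 ⊢
      simp only [SignType.coe_neg_one]
      linarith
    · rw [sign_pos hneg]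
      rw [abs_of_pos hneg] at h4 ⊢
      simp only [SignType.coe_one]
      linarith
  have hsum : ∑ k ∈ cube d ((1 + s) * L), |(SignType.sign c : ℝ) * latticeMonomial I k|
      ≤ (1 + s : ℝ) ^ (d + p) * (2 * (L : ℝ) + 1) ^ (d + p) := by
    have hsign : |(SignType.sign c : ℝ)| = 1 := by
      rcases lt_or_gt_of_ne hc0 with h | h
      · simp [sign_neg h]
      · simp [sign_pos h]
    have hcard : ((cube d ((1 + s) * L)).card : ℝ) ≤ ((1 + s) * (2 * (L : ℝ) + 1)) ^ d := by
      have h1 : (cube d ((1 + s) * L)).card = (2 * ((1 + s) * L) + 1) ^ d := by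
        rw [cube, Pi.card_Icc]
        simp only [Int.card_Icc, Finset.prod_const, Finset.card_univ, Fintype.card_fin]
        congr 1
        omega
      rw [h1]
      push_cast
      refine pow_le_pow_left₀ (by positivity) ?_ _
      linarith
    calc ∑ k ∈ cube d ((1 + s) * L), |(SignType.sign c : ℝ) * latticeMonomial I k|
        ≤ ∑ _k ∈ cube d ((1 + s) * L), ((1 + s) * (2 * (L : ℝ) + 1)) ^ p := by
          refine Finset.sum_le_sum fun k hk => ?_
          rw [abs_mul, hsign, one_mul]
          refine abs_latticeMonomial_le fun i => ?_
          rw [mem_cube] at hk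
          have h1 : |k i| ≤ (((1 + s) * L : ℕ) : ℤ) := by
            have := hk i
            rw [Int.abs_eq_natAbs]
            exact_mod_cast this
          have h2 : |(k i : ℝ)| ≤ (1 + s) * L := by exact_mod_cast h1
          have h3 : (0 : ℝ) ≤ L := by positivity
          refine h2.trans (mul_le_mul_of_nonneg_left ?_ (by positivity))
          linarith
      _ = (cube d ((1 + s) * L)).card * ((1 + s) * (2 * (L : ℝ) + 1)) ^ p := by
          rw [Finset.sum_const, nsmul_eq_mul]
      _ ≤ ((1 + s) * (2 * (L : ℝ) + 1)) ^ d * ((1 + s) * (2 * (L : ℝ) + 1)) ^ p := by gcongr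
      _ = _ := by rw [← pow_add, mul_pow]
  -- The support may be infinite, so the number of affected sites is bounded by the size of the
  -- cube; this accounts for the second `d` in the exponent `2d + |I|`.
  have hbound := wegnerBound_of_covering hρ (cube d ((1 + s) * L))
    (fun k => (SignType.sign c : ℝ) * latticeMonomial I k) (half_pos hpos) hcov ((2 * L + 1) ^ d)
    (fun k _ => card_filter_le_card_cube u L k) (ae_summable_of_isBounded_support husum hρ hb)
    hlam E hε
  refine hbound.mono ?_
  calc ε / (lam * (|c| / 2)) *
        (∑ k ∈ cube d ((1 + s) * L), |(SignType.sign c : ℝ) * latticeMonomial I k|)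
        * (((2 * L + 1) ^ d : ℕ) : ℝ) * bvNorm ρ
      ≤ ε / (lam * (|c| / 2)) * ((1 + s : ℝ) ^ (d + p) * (2 * (L : ℝ) + 1) ^ (d + p))
        * (((2 * L + 1) ^ d : ℕ) : ℝ) * bvNorm ρ := by gcongr
    _ = _ := by
        rw [hcabs, show 2 * d + p = (d + p) + d by ring, pow_add _ (d + p) d]
        push_cast
        field_simp

theorem exists_wegner_constant_of_exp_decay {u : (Fin d → ℤ) → ℝ} (husum : Summable u)
    (hu0 : u ≠ 0) (hdecay : ∃ C α : ℝ, 0 < C ∧ 0 < α ∧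
      ∀ k, |u k| ≤ C * Real.exp (-α * (l1norm k : ℝ))) :
    ∃ (c : ℝ) (I₀ : Fin d → ℕ), 0 < c ∧
      ∀ (μ : Measure ℝ) [IsProbabilityMeasure μ] (ρ : ℝ → ℝ), IsBVDensity μ ρ →
      Bornology.IsBounded (Function.support ρ) →
      ∀ lam : ℝ, 0 < lam → ∀ L : ℕ, 1 ≤ L → ∀ E ε : ℝ, 0 < ε →
        WegnerBound u lam μ L E ε
          (c / lam * bvNorm ρ * ε * (2 * (L : ℝ) + 1) ^ (2 * d + ∑ i, I₀ i)) := by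
  obtain ⟨C, α, -, hα, hu⟩ := hdecay
  obtain ⟨I', hI'⟩ := exists_moment_ne_zero_of_exp_decay hu0 hα hu
  obtain ⟨I, -, hI, hlow⟩ := exists_minimal_moment_ne_zero hI'
  have hI0 : 0 < |moment u I| := abs_pos.2 hI
  -- This depends on `u` and `I` only. The successor of `s` is used below, so that the truncation
  -- parameter is at least 1.
  obtain ⟨s, hs⟩ := exists_nat_ge (2 ^ (∑ i, I i) *
    (∑' k, (l1norm k : ℝ) ^ (∑ i, I i + 1) * |u k|) / (|moment u I| / 2))
  rw [div_le_iff₀ (half_pos hI0)] at hs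
  refine ⟨2 * (1 + (s + 1 : ℕ) : ℝ) ^ (d + ∑ i, I i) / |moment u I|, I, by positivity, ?_⟩
  intro μ _ ρ hρ hb lam hlam L hL E ε hε
  refine wegnerBound_exp_decay husum hα hu hI hlow (Nat.le_add_left 1 s) (hs.trans ?_) hρ hb
    hlam hL E hε
  gcongr
  exact Nat.le_succ s

end ExponentialDecay

end AlloyType

end

theorem mainTheorem6 (d : ℕ) (hd : 1 ≤ d) (u : (Fin d → ℤ) → ℝ) (hu : Summable u)
    (hu0 : u ≠ 0) :
    -- part (a)
    (∃ c : ℝ, 0 < c ∧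
      ∀ n : ℕ, (∀ k, u k ≠ 0 → ∀ i, 0 ≤ k i ∧ k i ≤ (n : ℤ)) →
      ∀ (μ : Measure ℝ) [IsProbabilityMeasure μ] (ρ : ℝ → ℝ), AlloyType.IsBVDensity μ ρ →
      ∀ lam : ℝ, 0 < lam → ∀ L : ℕ, 1 ≤ L → ∀ E ε : ℝ, 0 < ε →
        AlloyType.WegnerBound u lam μ L E ε
          (c / lam * ((Function.support u).ncard : ℝ) * AlloyType.bvNorm ρ * ε *
            (2 * (L : ℝ) + n) ^ (d * (n + 1)))) ∧
    -- part (b)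
    ((∑' k, u k) ≠ 0 →
      ∀ (μ : Measure ℝ) [IsProbabilityMeasure μ] (ρ : ℝ → ℝ), AlloyType.IsBVDensity μ ρ →
      HasCompactSupport ρ →
      ∀ m : ℕ,
        (∑' k : {k : Fin d → ℤ | (m : ℤ) ≤ AlloyType.l1norm k}, |u k|) ≤ |(∑' k, u k) / 2| →
      ∀ lam : ℝ, 0 < lam → ∀ L : ℕ, 1 ≤ L → ∀ E ε : ℝ, 0 < ε →
        AlloyType.WegnerBound u lam μ L E ε
          (8 / (lam * |∑' k, u k|) * (AlloyType.minSupp u ((2 * L + 1) ^ d) : ℝ) *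
            AlloyType.bvNorm ρ * ε * (2 * (L : ℝ) + m) ^ d) ∧
        (d ≤ L → AlloyType.WegnerBound u lam μ L E ε
          (8 / (lam * |∑' k, u k|) * (AlloyType.minSupp u ((2 * L) ^ d) : ℝ) *
            AlloyType.bvNorm ρ * ε * (2 * (L : ℝ) + m) ^ d))) ∧
    -- part (c)
    ((∃ C α : ℝ, 0 < C ∧ 0 < α ∧
        ∀ k, |u k| ≤ C * Real.exp (-α * (AlloyType.l1norm k : ℝ))) →
      ∃ (c : ℝ) (I₀ : Fin d → ℕ), 0 < c ∧
      ∀ (μ : Measure ℝ) [IsProbabilityMeasure μ] (ρ : ℝ → ℝ), AlloyType.IsBVDensity μ ρ →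
      Bornology.IsBounded (Function.support ρ) →
      ∀ lam : ℝ, 0 < lam → ∀ L : ℕ, 1 ≤ L → ∀ E ε : ℝ, 0 < ε →
        AlloyType.WegnerBound u lam μ L E ε
          (c / lam * AlloyType.bvNorm ρ * ε *
            (2 * (L : ℝ) + 1) ^ (2 * d + ∑ i, I₀ i))) := by
  exact ⟨AlloyType.exists_wegner_constant_of_support hu0,
    fun hmean μ _ ρ hρ hsupp m hm lam hlam L hL E ε hε =>
      AlloyType.wegnerBound_nonzero_mean hu hmean hρ hsupp hm hlam hL E hε,
    fun hdecay => AlloyType.exists_wegner_constant_of_exp_decay hu hu0 hdecay⟩
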